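/- Let $\mathbb F_4=\mathbb F_2(\omega)$ with $\omega^2+\omega+1=0$. For a binary linear code $\mathcal C_1\subseteq\mathbb F_2^{18}$ and a quaternary linear code $\mathcal C_2\subseteq\mathbb F_4^{18}$ put $$\phi(\mathcal C_1,\mathcal C_2)=\{(x+a\mid x+b\mid x+a+b)\ :\ x\in\mathcal C_1,\ a,b\in\mathbb F_2^{18},\ a+\omega b\in\mathcal C_2\}\subseteq\mathbb F_2^{54}.$$ Binary codes of length 18 and 54 are called self-dual with respect to the Euclidean inner product, and quaternary codes with respect to the Hermitian inner product $\sum_j u_j v_j^2$; binary codes are called equivalent if they differ by a permutation of coordinates. A binary self-dual code is of Type I if some codeword has weight not divisible by 4, and a code of length 54 is 18-quasi-cyclic (cubic) if it contains $(c_2\mid c_0\mid c_1)$ whenever it contains $(c_0\mid c_1\mid c_2)$, $c_i\in\mathbb F_2^{18}$. A self-dual $[54,27,10]$ code is said to have weight enumerator $W_1$, respectively $W_2$, with parameter $\beta$ if its weight enumerator is, up to terms of degree at least 16, $$W_1=1+(351-8\beta)y^{10}+(5031+24\beta)y^{12}+(48492+32\beta)y^{14}+\cdots,$$ $$W_2=1+(351-8\beta)y^{10}+(5543+24\beta)y^{12}+(43884+32\beta)y^{14}+\cdots.$$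 There exist two inequivalent binary self-dual $[18,9,4]$ codes $B_0,B_1$, two quaternary Hermitian self-dual $[18,9,6]$ codes $Q_0,Q_1$ that are inequivalent (even under permutations of coordinates combined with rescaling of coordinates and field automorphisms), and a set of 14 pairwise inequivalent binary codes of length 54, each of which is a cubic (18-quasi-cyclic) Type I self-dual $[54,27,10]$ code of the form $\phi(B_i,D)$, where $D$ is obtained from some $Q_j$ by a permutation of the coordinates, such that each of $B_0,B_1,Q_0,Q_1$ is used for at least one of the 14 codes and 1. for every $\beta\in\{0,3,6,9,12,15,18,21\}$ one of the 14 codes has weight enumerator $W_1$ with parameter $\beta$; 2. for every $\beta\in\{12,15,18,21,24,27\}$ one of the 14 codes has weight enumerator $W_2$ with parameter $\beta$; 3. every code among the 14 with weight enumerator $W_1$, $\beta=21$, is inequivalent to every binary linear code of length 54 whose weight enumerator agrees, up to terms of degree at least 16, with $W_1$ for some $\beta\in\{0,3,6,9,12,15,18\}$ or with $W_2$ for some $\beta\in\{12,15,18,21,24,27\}$ (the enumerators of the 13 previously known cubic codes). -/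

import Mathlib

open Polynomial

namespace CubicCode

section General

open Classical in
/-- The Hamming distance of two words. -/
noncomputable def dist {ι K : Type*} [Fintype ι] (c d : ι → K) : ℕ := hammingDist c d

theorem dist_eq_hammingDist {ι K : Type*} [Fintype ι] [DecidableEq K] (c d : ι → K) : dist c d = hammingDist c d := by
  unfold dist
  congr!

variable {ι K : Type*} [Fintype ι] [Field K]

open Classical in
/-- The Hamming weight of a word. -/
noncomputable def wt (c : ι → K) : ℕ := hammingNorm c

theorem wt_eq_hammingNorm [DecidableEq K] (c : ι → K) : wt c = hammingNorm c := by
  unfold wt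
  congr!

/-- `C` is an `[n, k, d]` linear code: length `n`, dimension `k`, and `d` is the minimum
distance between distinct codewords. -/
def IsLinearCode (C : Submodule K (ι → K)) (n k d : ℕ) : Prop :=
  Fintype.card ι = n ∧ Module.finrank K C = k ∧
    IsLeast {t : ℕ | ∃ c ∈ C, ∃ c' ∈ C, c ≠ c' ∧ dist c c' = t} d

/-- `A_i`, the number of codewords of weight `i`. -/
noncomputable def numWeight (C : Submodule K (ι → K)) (i : ℕ) : ℕ :=
  {c : ι → K | c ∈ C ∧ wt c = i}.ncard

/-- The Hamming weight enumerator `∑ A_i y^i`, `0 ≤ i ≤ n`. -/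
noncomputable def weightEnumerator (C : Submodule K (ι → K)) : ℤ[X] :=
  ∑ i ∈ Finset.range (Fintype.card ι + 1), Polynomial.C (numWeight C i : ℤ) * X ^ i

/-- The Euclidean dual `{u | ∑ u_j v_j = 0 for all v ∈ C}`. -/
def euclideanDual (C : Submodule K (ι → K)) : Submodule K (ι → K) where
  carrier := {u | ∀ v ∈ C, ∑ j, u j * v j = 0}
  add_mem' := by
    intro a b ha hb v hv
    simp [add_mul, Finset.sum_add_distrib, ha v hv, hb v hv]
  zero_mem' := by
    intro v _
    simp
  smul_mem' := by
    intro r a ha v hv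
    simp [mul_assoc, ← Finset.mul_sum, ha v hv]

/-- Self-duality for the Euclidean inner product. -/
def IsEuclideanSelfDual (C : Submodule K (ι → K)) : Prop := C = euclideanDual C

/-- Two codes are equivalent up to permutation if they differ only in the order of the
coordinates. -/
def PermEquiv (C D : Submodule K (ι → K)) : Prop :=
  ∃ σ : Equiv.Perm ι, ∀ c : ι → K, c ∈ C ↔ (fun j => c (σ j)) ∈ D

/-- The widest equivalence of codes over a field: permutation of the coordinates, rescaling of
each coordinate by a nonzero scalar, and a field automorphism applied to all coordinates. -/
def SemilinearEquiv (C D : Submodule K (ι → K)) : Prop :=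
  ∃ (σ : Equiv.Perm ι) (a : ι → Kˣ) (τ : K ≃+* K),
    ∀ c : ι → K, c ∈ C ↔ (fun j => (a j : K) * τ (c (σ j))) ∈ D

end General

section Quaternary

variable {ι : Type*} [Fintype ι]

/-- The field with four elements. -/
abbrev F4 : Type := GaloisField 2 2

/-- The Hermitian dual `{u | ∑ u_j conj (v_j) = 0 for all v ∈ C}` over `F4`, where the
conjugation is `y ↦ y ^ 2`. -/
def hermitianDual (C : Submodule F4 (ι → F4)) : Submodule F4 (ι → F4) where
  carrier := {u | ∀ v ∈ C, ∑ j, u j * v j ^ 2 = 0}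
  add_mem' := by
    intro a b ha hb v hv
    simp [add_mul, Finset.sum_add_distrib, ha v hv, hb v hv]
  zero_mem' := by
    intro v _
    simp
  smul_mem' := by
    intro r a ha v hv
    simp [mul_assoc, ← Finset.mul_sum, ha v hv]

/-- Self-duality for the Hermitian inner product. -/
def IsHermitianSelfDual (C : Submodule F4 (ι → F4)) : Prop := C = hermitianDual C

end Quaternary

section Binary

/-- A binary code is of Type I (singly-even) if some codeword has weight not divisible by 4. -/
def HasSinglyEvenWord {ι : Type*} [Fintype ι] (C : Submodule (ZMod 2) (ι → ZMod 2)) : Prop :=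
  ∃ c ∈ C, ¬ 4 ∣ wt c

/-- A binary word of length `m ℓ` is indexed by (block, position in the block). The code is
`ℓ`-quasi-cyclic if it contains `(c_{m-1} | c_0 | ⋯ | c_{m-2})` whenever it contains
`(c_0 | c_1 | ⋯ | c_{m-1})`. -/
def IsQuasiCyclic {m ℓ : ℕ} [NeZero m]
    (C : Submodule (ZMod 2) (Fin m × Fin ℓ → ZMod 2)) : Prop :=
  ∀ c ∈ C, (fun p : Fin m × Fin ℓ => c (p.1 - 1, p.2)) ∈ C

variable {ℓ : ℕ}

/-- The word `(x + a | x + b | x + a + b)` of length `3 ℓ`. -/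
def cubicWord (x a b : Fin ℓ → ZMod 2) : Fin 3 × Fin ℓ → ZMod 2 :=
  fun p => ![x + a, x + b, x + a + b] p.1 p.2

/-- The word `a + ω b` over `F4`, for binary words `a`, `b`. -/
noncomputable def quaternaryWord (ω : F4) (a b : Fin ℓ → ZMod 2) : Fin ℓ → F4 :=
  fun j => algebraMap (ZMod 2) F4 (a j) + ω * algebraMap (ZMod 2) F4 (b j)

theorem cubicWord_add (x a b x' a' b' : Fin ℓ → ZMod 2) :
    cubicWord x a b + cubicWord x' a' b' = cubicWord (x + x') (a + a') (b + b') := by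
  funext ⟨i, j⟩
  fin_cases i <;> simp [cubicWord] <;> ring

theorem cubicWord_smul (r : ZMod 2) (x a b : Fin ℓ → ZMod 2) :
    r • cubicWord x a b = cubicWord (r • x) (r • a) (r • b) := by
  funext ⟨i, j⟩
  fin_cases i <;> simp [cubicWord] <;> ring

theorem quaternaryWord_add (ω : F4) (a b a' b' : Fin ℓ → ZMod 2) :
    quaternaryWord ω (a + a') (b + b') = quaternaryWord ω a b + quaternaryWord ω a' b' := by
  funext j
  simp only [quaternaryWord, Pi.add_apply, map_add]
  ring

theorem quaternaryWord_smul (ω : F4) (r : ZMod 2) (a b : Fin ℓ → ZMod 2) :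
    quaternaryWord ω (r • a) (r • b) = (algebraMap (ZMod 2) F4 r) • quaternaryWord ω a b := by
  funext j
  simp only [quaternaryWord, Pi.smul_apply, smul_eq_mul, map_mul]
  ring

/-- The cubic construction
`{(x + a | x + b | x + a + b) : x ∈ C₁, a + ω b ∈ C₂}` from a binary code `C₁` and a quaternary
code `C₂`, both of length `ℓ`. -/
def cubicConstruction (ω : F4) (C₁ : Submodule (ZMod 2) (Fin ℓ → ZMod 2))
    (C₂ : Submodule F4 (Fin ℓ → F4)) : Submodule (ZMod 2) (Fin 3 × Fin ℓ → ZMod 2) where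
  carrier := {c | ∃ x ∈ C₁, ∃ a b : Fin ℓ → ZMod 2,
    quaternaryWord ω a b ∈ C₂ ∧ c = cubicWord x a b}
  add_mem' := by
    rintro _ _ ⟨x, hx, a, b, hab, rfl⟩ ⟨x', hx', a', b', hab', rfl⟩
    exact ⟨x + x', C₁.add_mem hx hx', a + a', b + b',
      by rw [quaternaryWord_add]; exact C₂.add_mem hab hab', cubicWord_add ..⟩
  zero_mem' := by
    refine ⟨0, C₁.zero_mem, 0, 0, ?_, ?_⟩
    · have h : quaternaryWord ω (0 : Fin ℓ → ZMod 2) 0 = 0 := by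
        funext j
        simp [quaternaryWord]
      rw [h]
      exact C₂.zero_mem
    · funext ⟨i, j⟩
      fin_cases i <;> simp [cubicWord]
  smul_mem' := by
    rintro r _ ⟨x, hx, a, b, hab, rfl⟩
    exact ⟨r • x, C₁.smul_mem r hx, r • a, r • b,
      by rw [quaternaryWord_smul]; exact C₂.smul_mem _ hab, cubicWord_smul ..⟩

end Binary

section Length54

/-- The terms of degree at most 15 of the first weight enumerator `W₁`. -/
noncomputable def W₁ (β : ℤ) : ℤ[X] :=
  1 + Polynomial.C (351 - 8 * β) * X ^ 10 + Polynomial.C (5031 + 24 * β) * X ^ 12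
    + Polynomial.C (48492 + 32 * β) * X ^ 14

/-- The terms of degree at most 15 of the second weight enumerator `W₂`. -/
noncomputable def W₂ (β : ℤ) : ℤ[X] :=
  1 + Polynomial.C (351 - 8 * β) * X ^ 10 + Polynomial.C (5543 + 24 * β) * X ^ 12
    + Polynomial.C (43884 + 32 * β) * X ^ 14

/-- The weight enumerator of `C` agrees with `W` in all degrees at most 15. For a self-dual
`[54, 27, 10]` code and `W = W₁ β` or `W = W₂ β` these terms determine the enumerator. -/
def HasEnumerator (C : Submodule (ZMod 2) (Fin 3 × Fin 18 → ZMod 2)) (W : ℤ[X]) : Prop :=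
  ∀ i ≤ 15, (weightEnumerator C).coeff i = W.coeff i

end Length54

end CubicCode

/-!
The weight of `(x + a | x + b | x + a + b)` is `3 |x| + 2 |S| - 4 |x ∩ S|`, where `S` is the
support of `q = a + ω b` (`wt_cubicWord`): only the supports of the quaternary words matter.
Let `B` and `D` be self-dual components with minimum weights 4 and 6. The inner product on length 54
is that of `B` plus the symplectic coordinate of the Hermitian product of `D`, so the cubic code is
self-dual (`isEuclideanSelfDual_cubicConstruction`). It has no nonzero word of weight less than 10
if and only if no word of weight 4 of `B` lies in a support of weight 6 of `D`, and no word of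
weight 6 or 8 of `B` is a support of `D` (`IsExtremalPair`).

The weight enumerator is found without counting words of the long code. If the coset `s + B` is the
shadow of `B`, then `(s | s | s)` defines the shadow of the cubic code, a coset whose weights are 3
mod 4. The MacWilliams identity expresses the weight distribution of the code through that of the
shadow (`macWilliams_coset`, `two_pow_mul_numWeight`). As the code has no words of weight
2, 4, 6, 8, all numbers of shadow words but those of weights 3 and 7 can be eliminated, and they
determine the numbers of codewords of weights 10, 12 and 14 (`IsExtremalPair.numWeight_eq`).
A shadow word of weight 3 comes from a word of weight 1 in `s + B`, and one of weight 7 from a word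
of weight 5 in `s + B` contained in a support of weight 6 of `D`. Hence `B` alone decides between
`W₁` and `W₂`, and `β` is the number of such containments, increased by 12 in the case of `W₂`.

It remains to exhibit components and orders of the coordinates. The two self-dual `[18, 9, 4]` codes
give the two enumerators. All quaternary words up to scalar multiples are enumerated as bit
masks (`allNormalized_quaternaryRows`), which gives the supports of weight 6 and excludes those of
weight 8 in `B`; the incidences with `B` are then counted (`avoidsHexad_permRows`,
`sum_pentadCount`). The fourteen codes have different enumerators, hence are inequivalent, and the
same comparison separates `W₁` with `β = 21` from the other thirteen enumerators.
-/

namespace CubicCode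

/-! ### Linear codes and their equivalences -/

section General

variable {ι K : Type*} [Fintype ι] [Field K]

theorem wt_eq_card [DecidableEq K] (c : ι → K) :
    wt c = (Finset.univ.filter fun j => c j ≠ 0).card := by
  rw [wt_eq_hammingNorm]; rfl

theorem wt_eq_sum [DecidableEq K] (c : ι → K) : wt c = ∑ j, if c j ≠ 0 then 1 else 0 := by
  rw [wt_eq_card, Finset.card_filter]

theorem wt_zero : wt (0 : ι → K) = 0 := by
  classical
  rw [wt_eq_hammingNorm, hammingNorm_zero]

theorem wt_eq_zero {c : ι → K} : wt c = 0 ↔ c = 0 := by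
  classical
  rw [wt_eq_hammingNorm, hammingNorm_eq_zero]

theorem wt_le_card (c : ι → K) : wt c ≤ Fintype.card ι := by
  classical
  rw [wt_eq_hammingNorm]; exact hammingNorm_le_card_fintype

theorem wt_comp_perm (c : ι → K) (σ : Equiv.Perm ι) : wt (fun j => c (σ j)) = wt c := by
  classical
  rw [wt_eq_sum, wt_eq_sum]
  exact Equiv.sum_comp σ fun j => if c j ≠ 0 then 1 else 0

/-- By linearity the minimum distance is the minimum weight. -/
theorem isLeast_dist {C : Submodule K (ι → K)} {d : ℕ} (hmin : ∀ c ∈ C, c ≠ 0 → d ≤ wt c)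
    (hex : ∃ c ∈ C, c ≠ 0 ∧ wt c = d) :
    IsLeast {t : ℕ | ∃ c ∈ C, ∃ c' ∈ C, c ≠ c' ∧ dist c c' = t} d := by
  classical
  have key (c c' : ι → K) : dist c c' = wt (c - c') := by
    rw [dist_eq_hammingDist, hammingDist_comm, hammingDist_eq_hammingNorm, wt_eq_hammingNorm]
    congr 1
    abel
  constructor
  · obtain ⟨c, hc, hc0, rfl⟩ := hex
    exact ⟨c, hc, 0, C.zero_mem, hc0, by rw [key, sub_zero]⟩
  · rintro t ⟨c, hc, c', hc', hne, rfl⟩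
    rw [key]
    exact hmin _ (C.sub_mem hc hc') (sub_ne_zero.2 hne)

theorem PermEquiv.numWeight_eq {C D : Submodule K (ι → K)} (h : PermEquiv C D) (i : ℕ) :
    numWeight C i = numWeight D i := by
  obtain ⟨σ, hσ⟩ := h
  refine Set.ncard_congr (fun c _ j => c (σ j)) ?_ ?_ ?_
  · rintro c ⟨hc, hw⟩
    exact ⟨(hσ c).1 hc, by rw [wt_comp_perm, hw]⟩
  · intro c d _ _ hcd
    funext j
    simpa using congrFun hcd (σ.symm j)
  · rintro d ⟨hd, hw⟩
    refine ⟨fun j => d (σ.symm j), ⟨(hσ _).2 (by simpa using hd), by rw [wt_comp_perm, hw]⟩, ?_⟩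
    simp

theorem SemilinearEquiv.numWeight_eq {C D : Submodule K (ι → K)} (h : SemilinearEquiv C D)
    (i : ℕ) : numWeight C i = numWeight D i := by
  classical
  obtain ⟨σ, a, τ, hσ⟩ := h
  have hwt (c : ι → K) : wt (fun j => (a j : K) * τ (c (σ j))) = wt c := by
    rw [← wt_comp_perm c σ, wt_eq_sum, wt_eq_sum]
    simp
  refine Set.ncard_congr (fun c _ j => (a j : K) * τ (c (σ j))) ?_ ?_ ?_
  · rintro c ⟨hc, hw⟩
    exact ⟨(hσ c).1 hc, by rw [hwt, hw]⟩
  · intro c d _ _ hcd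
    funext j
    simpa using congrFun hcd (σ.symm j)
  · rintro d ⟨hd, hw⟩
    have hd' : (fun j => (a j : K) * τ ((fun k => τ.symm (((a (σ.symm k))⁻¹ : Kˣ) * d (σ.symm k)))
        (σ j))) = d := by
      funext j
      simp
    refine ⟨fun k => τ.symm (((a (σ.symm k))⁻¹ : Kˣ) * d (σ.symm k)), ⟨?_, ?_⟩, hd'⟩
    · rw [hσ, hd']; exact hd
    · rw [← hwt, hd', hw]

theorem coeff_weightEnumerator (C : Submodule K (ι → K)) {i : ℕ} (hi : i ≤ Fintype.card ι) :
    (weightEnumerator C).coeff i = numWeight C i := by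
  simp only [weightEnumerator, finsetSum_coeff, coeff_C_mul, coeff_X_pow]
  simp only [mul_ite, mul_one, mul_zero]
  rw [Finset.sum_ite_eq, if_pos (Finset.mem_range.2 (by omega))]

/-- The sesquilinear dual of a subspace has complementary dimension. Taking the identity for the
automorphism gives the Euclidean case, taking the Frobenius the Hermitian case. -/
theorem finrank_add_finrank_of_mem_iff (τ : K ≃+* K) {C E : Submodule K (ι → K)}
    (hE : ∀ u, u ∈ E ↔ ∀ v ∈ C, ∑ j, u j * τ (v j) = 0) :
    Module.finrank K C + Module.finrank K E = Fintype.card ι := by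
  classical
  let b := Module.finBasis K C
  let M : Matrix (Fin (Module.finrank K C)) ι K := Matrix.of fun i j => τ ((b i : ι → K) j)
  have hrank : M.rank = Module.finrank K C := by
    have hli : LinearIndependent K fun i => (b i : ι → K) :=
      b.linearIndependent.map' C.subtype C.ker_subtype
    have hM : LinearIndependent K M.row := by
      refine hli.map_of_injective_injective (M' := ι → K) (R' := K) τ.symm
        ⟨⟨fun v j => τ (v j), by ext; simp⟩, fun v w => by ext; simp⟩ (by simp) ?_ ?_
      · intro v hv
        funext j
        simpa using congrFun hv j
      · intro r v
        ext j
        simp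
    simpa using hM.rank_matrix
  have hker : LinearMap.ker M.mulVecLin = E := by
    ext u
    rw [LinearMap.mem_ker, hE, Matrix.mulVecLin_apply]
    constructor
    · intro h v hv
      have hsum := b.sum_repr ⟨v, hv⟩
      have hv' : v = ∑ i, b.repr ⟨v, hv⟩ i • (b i : ι → K) := by
        have := congrArg C.subtype hsum
        rw [map_sum] at this
        exact this.symm
      have h' (i) : ∑ j, u j * τ ((b i : ι → K) j) = 0 := by
        have := congrFun h i
        simpa [Matrix.mulVec, dotProduct, M, mul_comm] using this
      rw [hv']
      simp only [Finset.sum_apply, Pi.smul_apply, smul_eq_mul, map_sum, map_mul, Finset.mul_sum]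
      rw [Finset.sum_comm]
      refine Finset.sum_eq_zero fun i _ => ?_
      rw [← mul_zero (τ (b.repr ⟨v, hv⟩ i)), ← h' i, Finset.mul_sum]
      exact Finset.sum_congr rfl fun j _ => by ring
    · intro h
      funext i
      simpa [Matrix.mulVec, dotProduct, M, mul_comm] using h _ (b i).2
  have := LinearMap.finrank_range_add_finrank_ker M.mulVecLin
  rw [hker, Module.finrank_fintype_fun_eq_card] at this
  rw [← this]
  exact congrArg (· + _) hrank.symm

theorem IsEuclideanSelfDual.two_mul_finrank {C : Submodule K (ι → K)}
    (h : IsEuclideanSelfDual C) : 2 * Module.finrank K C = Fintype.card ι := by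
  rw [two_mul]
  refine finrank_add_finrank_of_mem_iff (RingEquiv.refl K) fun u => ?_
  conv_lhs => rw [h]
  rfl

end General

/-- Conjugation of `F4`. -/
noncomputable def conjF4 : F4 ≃+* F4 := frobeniusEquiv F4 2

theorem finrank_add_finrank_hermitianDual {ι : Type*} [Fintype ι] (C : Submodule F4 (ι → F4)) :
    Module.finrank F4 C + Module.finrank F4 (hermitianDual C) = Fintype.card ι :=
  finrank_add_finrank_of_mem_iff conjF4 fun _ => Iff.rfl

theorem finrank_add_finrank_euclideanDual {ι K : Type*} [Fintype ι] [Field K]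
    (C : Submodule K (ι → K)) :
    Module.finrank K C + Module.finrank K (euclideanDual C) = Fintype.card ι :=
  finrank_add_finrank_of_mem_iff (RingEquiv.refl K) fun _ => Iff.rfl

/-- A self-orthogonal code of half the length in dimension is self-dual. -/
theorem isEuclideanSelfDual_of_le {ι K : Type*} [Fintype ι] [Field K] {C : Submodule K (ι → K)}
    (hle : C ≤ euclideanDual C) (hC : 2 * Module.finrank K C = Fintype.card ι) :
    IsEuclideanSelfDual C :=
  Submodule.eq_of_le_of_finrank_eq hle (by
    have := finrank_add_finrank_euclideanDual C
    omega)

theorem isHermitianSelfDual_of_le {ι : Type*} [Fintype ι] {C : Submodule F4 (ι → F4)}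
    (hle : C ≤ hermitianDual C) (hC : 2 * Module.finrank F4 C = Fintype.card ι) :
    IsHermitianSelfDual C :=
  Submodule.eq_of_le_of_finrank_eq hle (by
    have := finrank_add_finrank_hermitianDual C
    omega)

/-- As `x ^ 3 = 1` for nonzero `x` in `F4`, the Hermitian norm of a word is its weight mod 2. -/
theorem IsHermitianSelfDual.even_wt {ι : Type*} [Fintype ι] {C : Submodule F4 (ι → F4)}
    (h : IsHermitianSelfDual C) {c : ι → F4} (hc : c ∈ C) : Even (wt c) := by
  classical
  have h0 : ∑ j, c j * c j ^ 2 = 0 := by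
    rw [h] at hc
    exact hc c (by rw [h]; exact hc)
  have hone (x : F4) : x * x ^ 2 = if x ≠ 0 then 1 else 0 := by
    split_ifs with hx
    · have := Fintype.ofFinite F4
      have := FiniteField.pow_card_sub_one_eq_one x hx
      have hcard : Fintype.card F4 = 4 := by
        rw [← Nat.card_eq_fintype_card, GaloisField.card 2 2 (by norm_num)]; norm_num
      rw [hcard] at this
      rw [← this]; ring
    · simp only [ne_eq, not_not] at hx
      simp [hx]
  have : ((wt c : ℕ) : F4) = 0 := by
    rw [wt_eq_sum, Nat.cast_sum]
    refine Eq.trans (Finset.sum_congr rfl fun j _ => ?_) h0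
    rw [hone]; push_cast; rfl
  rw [CharP.cast_eq_zero_iff F4 2] at this
  exact even_iff_two_dvd.2 this

/-! ### The MacWilliams identity for a coset of a self-dual code -/

section MacWilliams

variable {ι : Type*} [Fintype ι]

/-- The nontrivial character of `ZMod 2`. -/
def sgn (e : ZMod 2) : ℤ := if e = 0 then 1 else -1

theorem sgn_add (a b : ZMod 2) : sgn (a + b) = sgn a * sgn b := by
  revert a b; decide

theorem sgn_sum {α : Type*} (s : Finset α) (f : α → ZMod 2) :
    sgn (∑ a ∈ s, f a) = ∏ a ∈ s, sgn (f a) := by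
  classical
  induction s using Finset.induction_on with
  | empty => simp [sgn]
  | insert a s ha ih => rw [Finset.sum_insert ha, Finset.prod_insert ha, sgn_add, ih]

open Classical in
/-- The signed weight enumerator of the full space, factored over the coordinates. -/
theorem sum_sgn_dot_mul_X_pow_wt (w : ι → ZMod 2) :
    ∑ v : ι → ZMod 2, C (sgn (∑ j, w j * v j)) * (X : ℤ[X]) ^ wt v
      = (1 - X) ^ wt w * (1 + X) ^ (Fintype.card ι - wt w) := by
  classical
  have hterm (v : ι → ZMod 2) : C (sgn (∑ j, w j * v j)) * (X : ℤ[X]) ^ wt v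
      = ∏ j, (C (sgn (w j * v j)) * X ^ (if v j ≠ 0 then 1 else 0)) := by
    rw [sgn_sum, wt_eq_sum, Finset.prod_mul_distrib, map_prod, Finset.prod_pow_eq_pow_sum]
  have hfac (j : ι) : ∑ e : ZMod 2, (C (sgn (w j * e)) * (X : ℤ[X]) ^ (if e ≠ 0 then 1 else 0))
      = if w j ≠ 0 then 1 - X else 1 + X := by
    have h : w j = 0 ∨ w j = 1 := by generalize w j = e; revert e; decide
    have h2 (f : ZMod 2 → ℤ[X]) : ∑ e, f e = f 0 + f 1 := Fin.sum_univ_two f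
    rw [h2]
    rcases h with h | h <;> simp [h, sgn, sub_eq_add_neg]
  rw [Finset.sum_congr rfl fun v _ => hterm v]
  have hexp := Finset.prod_univ_sum (fun _ : ι => (Finset.univ : Finset (ZMod 2)))
    (fun j e => C (sgn (w j * e)) * (X : ℤ[X]) ^ (if e ≠ 0 then 1 else 0))
  rw [Fintype.piFinset_univ] at hexp
  rw [← hexp, Finset.prod_congr rfl fun j _ => hfac j,
    Finset.prod_ite, Finset.prod_const, Finset.prod_const, ← wt_eq_card]
  congr 2
  have := Finset.card_filter_add_card_filter_not (s := Finset.univ) (fun j => w j ≠ 0)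
  rw [← wt_eq_card, Finset.card_univ] at this
  omega

open Classical in
/-- A character of a code sums to zero unless it is trivial. -/
theorem sum_sgn_dot (C : Submodule (ZMod 2) (ι → ZMod 2)) (v : ι → ZMod 2) :
    ∑ c with c ∈ C, sgn (∑ j, c j * v j)
      = if v ∈ euclideanDual C then 2 ^ Module.finrank (ZMod 2) C else 0 := by
  split_ifs with hv
  · have hcard : (Finset.univ.filter (· ∈ C)).card = 2 ^ Module.finrank (ZMod 2) C := by
      have := Module.card_eq_pow_finrank (K := ZMod 2) (V := C)
      rw [ZMod.card] at this
      rw [← this]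
      exact (Fintype.card_subtype _).symm
    rw [Finset.sum_congr rfl (g := fun _ => (1 : ℤ))]
    · simp [hcard]
    · intro c hc
      have : ∑ j, c j * v j = 0 := by
        rw [← hv c (Finset.mem_filter.1 hc).2]
        exact Finset.sum_congr rfl fun j _ => mul_comm _ _
      simp [this, sgn]
  · obtain ⟨c₀, hc₀, hne⟩ : ∃ c ∈ C, ∑ j, c j * v j ≠ 0 := by
      by_contra! h
      refine hv fun c hc => ?_
      rw [← h c hc]
      exact Finset.sum_congr rfl fun j _ => mul_comm _ _
    have hneg : ∑ c with c ∈ C, sgn (∑ j, c j * v j) = -∑ c with c ∈ C, sgn (∑ j, c j * v j) := by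
      rw [← Finset.sum_neg_distrib]
      refine Finset.sum_nbij' (· + c₀) (· - c₀) ?_ ?_ ?_ ?_ ?_
      · intro c hc
        simpa using C.add_mem (by simpa using hc) hc₀
      · intro c hc
        simpa using C.sub_mem (by simpa using hc) hc₀
      · simp
      · simp
      · intro c _
        have : sgn (∑ j, c₀ j * v j) = -1 := by rw [sgn, if_neg hne]
        simp only [Pi.add_apply, add_mul, Finset.sum_add_distrib, sgn_add, this]
        ring
    omega

open Classical in
/-- The weight enumerator of a coset of a self-dual code, in terms of the weight enumerator of the
code with signs. -/
theorem macWilliams_coset {C : Submodule (ZMod 2) (ι → ZMod 2)} (hC : IsEuclideanSelfDual C)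
    (u : ι → ZMod 2) :
    (2 : ℤ[X]) ^ Module.finrank (ZMod 2) C *
        ∑ c with c ∈ C, Polynomial.C (sgn (∑ j, u j * c j)) * (X : ℤ[X]) ^ wt c
      = ∑ c with c ∈ C, (1 - X) ^ wt (u + c) * (1 + X) ^ (Fintype.card ι - wt (u + c)) := by
  simp_rw [← sum_sgn_dot_mul_X_pow_wt]
  rw [Finset.sum_comm, Finset.mul_sum, Finset.sum_filter]
  refine Finset.sum_congr rfl fun v _ => ?_
  have : ∑ c with c ∈ C, Polynomial.C (sgn (∑ j, (u + c) j * v j)) * (X : ℤ[X]) ^ wt v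
      = Polynomial.C (sgn (∑ j, u j * v j)) * X ^ wt v *
        Polynomial.C (∑ c with c ∈ C, sgn (∑ j, c j * v j)) := by
    rw [map_sum, Finset.mul_sum]
    refine Finset.sum_congr rfl fun c _ => ?_
    simp only [Pi.add_apply, add_mul, Finset.sum_add_distrib, sgn_add, map_mul]
    ring
  rw [this, sum_sgn_dot, ← hC]
  split_ifs
  · simp; ring
  · simp

/-- The number of words of weight `i` in the coset `u + C`. -/
noncomputable def cosetNumWeight (C : Submodule (ZMod 2) (ι → ZMod 2)) (u : ι → ZMod 2) (i : ℕ) :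
    ℕ := {c : ι → ZMod 2 | c ∈ C ∧ wt (u + c) = i}.ncard

/-- The value `K_w(i)` of the binary Krawtchouk polynomial for length `n`. -/
def krawtchouk (n w i : ℕ) : ℤ :=
  ∑ k ∈ Finset.range (w + 1), (-1) ^ k * (i.choose k * (n - i).choose (w - k) : ℕ)

theorem coeff_one_sub_X_pow_mul (n w i : ℕ) :
    ((1 - X : ℤ[X]) ^ i * (1 + X) ^ (n - i)).coeff w = krawtchouk n w i := by
  have h : (1 - X : ℤ[X]) ^ i = ((1 + X) ^ i : ℤ[X]).comp (C (-1) * X) := by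
    simp [sub_eq_add_neg]
  rw [coeff_mul, Finset.Nat.sum_antidiagonal_eq_sum_range_succ_mk, krawtchouk]
  refine Finset.sum_congr rfl fun k _ => ?_
  rw [h, comp_C_mul_X_coeff, coeff_one_add_X_pow, coeff_one_add_X_pow]
  push_cast
  ring

open Classical in
/-- If the inner product with `u` gives half the weight mod 2 of each word of a self-dual code,
so that the coset of `u` is the shadow of the code, the weight distribution of the shadow
determines that of the code. -/
theorem two_pow_mul_numWeight {C : Submodule (ZMod 2) (ι → ZMod 2)} (hC : IsEuclideanSelfDual C)
    {u : ι → ZMod 2} (hu : ∀ c ∈ C, sgn (∑ j, u j * c j) = (-1) ^ (wt c / 2)) (w : ℕ) :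
    (2 : ℤ) ^ Module.finrank (ZMod 2) C * ((-1) ^ (w / 2) * numWeight C w)
      = ∑ i ∈ Finset.range (Fintype.card ι + 1),
          cosetNumWeight C u i * krawtchouk (Fintype.card ι) w i := by
  have h := congrArg (fun p => coeff p w) (macWilliams_coset hC u)
  simp only [← C_ofNat, ← C_pow, coeff_C_mul, finsetSum_coeff, coeff_one_sub_X_pow_mul] at h
  have hl : ∑ c with c ∈ C, sgn (∑ j, u j * c j) * ((X : ℤ[X]) ^ wt c).coeff w
      = (-1) ^ (w / 2) * numWeight C w := by
    have : (numWeight C w : ℤ) = ∑ c with c ∈ C, if wt c = w then 1 else 0 := by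
      rw [numWeight, Set.ncard_eq_toFinset_card', Finset.sum_ite, Finset.filter_filter]
      simp
    rw [this, Finset.mul_sum]
    refine Finset.sum_congr rfl fun c hc => ?_
    rw [hu c (Finset.mem_filter.1 hc).2, coeff_X_pow]
    by_cases hw : wt c = w
    · simp [hw]
    · simp [hw, Ne.symm hw]
  rw [hl] at h
  rw [show (2 : ℤ) ^ Module.finrank (ZMod 2) C = OfNat.ofNat 2 ^ Module.finrank (ZMod 2) C from rfl]
  rw [h, ← Finset.sum_fiberwise_of_maps_to (t := Finset.range (Fintype.card ι + 1))
    (g := fun c => wt (u + c))]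
  · refine Finset.sum_congr rfl fun i _ => ?_
    rw [Finset.sum_congr rfl (g := fun _ => krawtchouk (Fintype.card ι) w i)]
    · rw [Finset.sum_const, Finset.filter_filter, cosetNumWeight, Set.ncard_eq_toFinset_card']
      simp
    · intro c hc
      rw [(Finset.mem_filter.1 hc).2]
  · intro c _
    exact Finset.mem_range_succ_iff.2 (wt_le_card _)

end MacWilliams

/-! ### The field with four elements over its prime field -/

theorem zmod_two_eq (e : ZMod 2) : e = 0 ∨ e = 1 := by revert e; decide

section FieldF4

variable {ω : F4} (hω : ω ^ 2 + ω + 1 = 0)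
include hω

theorem omega_sq : ω ^ 2 = ω + 1 := by
  have h2 : (2 : F4) = 0 := CharP.cast_eq_zero F4 2
  linear_combination hω - (ω + 1) * h2

theorem coord_eq_zero_iff (a b : ZMod 2) :
    algebraMap (ZMod 2) F4 a + ω * algebraMap (ZMod 2) F4 b = 0 ↔ a = 0 ∧ b = 0 := by
  have h2 : (2 : F4) = 0 := CharP.cast_eq_zero F4 2
  constructor
  · intro h
    rcases zmod_two_eq a with rfl | rfl <;> rcases zmod_two_eq b with rfl | rfl
    · simp
    · have h0 : ω = 0 := by simpa using h
      simp [h0] at hω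
    · simp at h
    · simp only [map_one, mul_one] at h
      have : (1 : F4) = 0 := by linear_combination hω - ω * h
      simp at this
  · rintro ⟨rfl, rfl⟩
    simp

theorem exists_coord (z : F4) :
    ∃ a b : ZMod 2, z = algebraMap (ZMod 2) F4 a + ω * algebraMap (ZMod 2) F4 b := by
  have hinj : Function.Injective fun p : ZMod 2 × ZMod 2 =>
      algebraMap (ZMod 2) F4 p.1 + ω * algebraMap (ZMod 2) F4 p.2 := by
    rintro ⟨a, b⟩ ⟨a', b'⟩ h
    have h' : algebraMap (ZMod 2) F4 (a - a') + ω * algebraMap (ZMod 2) F4 (b - b') = 0 := by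
      simp only at h
      rw [map_sub, map_sub]
      linear_combination h
    rw [coord_eq_zero_iff hω, sub_eq_zero, sub_eq_zero] at h'
    exact Prod.ext h'.1 h'.2
  have hbij := (Nat.bijective_iff_injective_and_card _).2 ⟨hinj, by
    rw [GaloisField.card 2 2 (by norm_num)]; simp⟩
  obtain ⟨⟨a, b⟩, h⟩ := hbij.2 z
  exact ⟨a, b, h.symm⟩

theorem exists_quaternaryWord {ℓ : ℕ} (q : Fin ℓ → F4) : ∃ a b, q = quaternaryWord ω a b := by
  choose a b h using fun j => exists_coord hω (q j)
  exact ⟨a, b, funext h⟩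

theorem quaternaryWord_apply_eq_zero {ℓ : ℕ} (a b : Fin ℓ → ZMod 2) (j : Fin ℓ) :
    quaternaryWord ω a b j = 0 ↔ a j = 0 ∧ b j = 0 :=
  coord_eq_zero_iff hω _ _

theorem quaternaryWord_injective {ℓ : ℕ} {a b a' b' : Fin ℓ → ZMod 2}
    (h : quaternaryWord ω a b = quaternaryWord ω a' b') : a = a' ∧ b = b' := by
  have h0 : quaternaryWord ω (a - a') (b - b') = 0 := by
    have := quaternaryWord_add ω (a - a') (b - b') a' b'
    rw [sub_add_cancel, sub_add_cancel, h] at this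
    simpa using this
  have hj (j) := (quaternaryWord_apply_eq_zero hω _ _ j).1 (congrFun h0 j)
  exact ⟨funext fun j => sub_eq_zero.1 (hj j).1, funext fun j => sub_eq_zero.1 (hj j).2⟩

theorem omega_smul_quaternaryWord {ℓ : ℕ} (a b : Fin ℓ → ZMod 2) :
    ω • quaternaryWord ω a b = quaternaryWord ω b (a + b) := by
  funext j
  simp only [quaternaryWord, Pi.smul_apply, smul_eq_mul, Pi.add_apply, map_add]
  linear_combination algebraMap (ZMod 2) F4 (b j) * omega_sq hω

/-- The Hermitian product in the basis `1, ω`; its `ω`-coordinate is a symplectic product. -/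
theorem sum_quaternaryWord_mul_sq {ℓ : ℕ} (a b a' b' : Fin ℓ → ZMod 2) :
    ∑ j, quaternaryWord ω a b j * quaternaryWord ω a' b' j ^ 2
      = algebraMap (ZMod 2) F4 (∑ j, (a j * a' j + b j * b' j + a j * b' j))
        + ω * algebraMap (ZMod 2) F4 (∑ j, (a j * b' j + b j * a' j)) := by
  rw [map_sum, map_sum, Finset.mul_sum, ← Finset.sum_add_distrib]
  refine Finset.sum_congr rfl fun j _ => ?_
  have h2 : (2 : F4) = 0 := CharP.cast_eq_zero F4 2
  have hsq (e : ZMod 2) : algebraMap (ZMod 2) F4 e ^ 2 = algebraMap (ZMod 2) F4 e := by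
    rw [← map_pow, ZMod.pow_card]
  have hcube : ω * ω ^ 2 = 1 := by
    have h := omega_sq hω
    linear_combination (ω + 1) * h + ω * h2
  simp only [quaternaryWord, map_add, map_mul, add_sq, mul_pow, hsq]
  generalize algebraMap (ZMod 2) F4 (a j) = A
  generalize algebraMap (ZMod 2) F4 (b j) = B
  generalize algebraMap (ZMod 2) F4 (a' j) = A'
  generalize algebraMap (ZMod 2) F4 (b' j) = B'
  linear_combination (A * A' * ω * B' + ω * B * A' * ω * B') * h2 + B * B' * hcube
    + A * B' * omega_sq hω

end FieldF4

/-! ### Self-duality and weights of the cubic construction -/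

section Cubic

theorem exists_cubicWord {ℓ : ℕ} (v : Fin 3 × Fin ℓ → ZMod 2) : ∃ x a b, v = cubicWord x a b := by
  refine ⟨fun j => v (0, j) + v (1, j) + v (2, j), fun j => v (1, j) + v (2, j),
    fun j => v (0, j) + v (2, j), ?_⟩
  funext ⟨i, j⟩
  have key (e f g : ZMod 2) : e = e + f + g + (f + g) ∧ f = e + f + g + (e + g) ∧
      g = e + f + g + (f + g) + (e + g) := by
    revert e f g; decide
  fin_cases i
  · exact (key _ _ _).1
  · exact (key _ _ _).2.1
  · exact (key _ _ _).2.2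

theorem cubicWord_injective {ℓ : ℕ} {x a b x' a' b' : Fin ℓ → ZMod 2}
    (h : cubicWord x a b = cubicWord x' a' b') : x = x' ∧ a = a' ∧ b = b' := by
  have key (x a b x' a' b' : ZMod 2) : x + a = x' + a' → x + b = x' + b' →
      x + a + b = x' + a' + b' → x = x' ∧ a = a' ∧ b = b' := by
    revert x a b x' a' b'; decide
  have hj (j : Fin ℓ) := key (x j) (a j) (b j) (x' j) (a' j) (b' j)
    (congrFun h (0, j)) (congrFun h (1, j)) (congrFun h (2, j))
  exact ⟨funext fun j => (hj j).1, funext fun j => (hj j).2.1, funext fun j => (hj j).2.2⟩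

theorem sum_block_prod {ℓ : ℕ} {M : Type*} [AddCommMonoid M] (f : Fin 3 × Fin ℓ → M) :
    ∑ p, f p = ∑ j, (f (0, j) + f (1, j) + f (2, j)) := by
  rw [Fintype.sum_prod_type_right]
  exact Finset.sum_congr rfl fun j _ => Fin.sum_univ_three _

/-- The inner product is that of the `x` plus the symplectic product of the pairs `(a, b)`. -/
theorem sum_cubicWord_mul {ℓ : ℕ} (x a b x' a' b' : Fin ℓ → ZMod 2) :
    ∑ p, cubicWord x a b p * cubicWord x' a' b' p
      = ∑ j, x j * x' j + ∑ j, (a j * b' j + b j * a' j) := by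
  rw [sum_block_prod, ← Finset.sum_add_distrib]
  refine Finset.sum_congr rfl fun j _ => ?_
  have key (x a b x' a' b' : ZMod 2) : (x + a) * (x' + a') + (x + b) * (x' + b') +
      (x + a + b) * (x' + a' + b') = x * x' + (a * b' + b * a') := by
    revert x a b x' a' b'; decide
  exact key _ _ _ _ _ _

variable {ℓ : ℕ} {ω : F4} {B : Submodule (ZMod 2) (Fin ℓ → ZMod 2)}
  {D : Submodule F4 (Fin ℓ → F4)}

theorem mem_cubicConstruction {x a b : Fin ℓ → ZMod 2} :
    cubicWord x a b ∈ cubicConstruction ω B D ↔ x ∈ B ∧ quaternaryWord ω a b ∈ D := by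
  constructor
  · rintro ⟨x', hx', a', b', hq, h⟩
    obtain ⟨rfl, rfl, rfl⟩ := cubicWord_injective h
    exact ⟨hx', hq⟩
  · rintro ⟨hx, hq⟩
    exact ⟨x, hx, a, b, hq, rfl⟩

theorem isEuclideanSelfDual_cubicConstruction (hω : ω ^ 2 + ω + 1 = 0)
    (hB : IsEuclideanSelfDual B) (hD : IsHermitianSelfDual D) :
    IsEuclideanSelfDual (cubicConstruction ω B D) := by
  have hzero : quaternaryWord ω (0 : Fin ℓ → ZMod 2) 0 = 0 := by
    funext j; simp [quaternaryWord]
  refine le_antisymm ?_ ?_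
  · rintro _ ⟨x, hx, a, b, hq, rfl⟩ _ ⟨x', hx', a', b', hq', rfl⟩
    rw [sum_cubicWord_mul]
    rw [hB] at hx
    rw [hD] at hq
    have h2 := hq _ hq'
    rw [sum_quaternaryWord_mul_sq hω, coord_eq_zero_iff hω] at h2
    rw [hx _ hx', h2.2, add_zero]
  · intro v hv
    obtain ⟨x, a, b, rfl⟩ := exists_cubicWord v
    rw [mem_cubicConstruction, hB, hD]
    constructor
    · intro x' hx'
      have := hv (cubicWord x' 0 0) ⟨x', hx', 0, 0, by rw [hzero]; exact D.zero_mem, rfl⟩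
      rw [sum_cubicWord_mul] at this
      simpa using this
    · have hsymp (a' b') (hq : quaternaryWord ω a' b' ∈ D) :
          ∑ j, (a j * b' j + b j * a' j) = 0 := by
        have := hv (cubicWord 0 a' b') ⟨0, B.zero_mem, a', b', hq, rfl⟩
        rw [sum_cubicWord_mul] at this
        simpa using this
      intro q hq
      obtain ⟨a', b', rfl⟩ := exists_quaternaryWord hω q
      rw [sum_quaternaryWord_mul_sq hω, coord_eq_zero_iff hω]
      refine ⟨?_, hsymp _ _ hq⟩
      -- The symplectic product with `ω q` is the other coordinate of the Hermitian product.
      have h1 := hsymp b' (a' + b') (by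
        rw [← omega_smul_quaternaryWord hω]; exact D.smul_mem ω hq)
      rw [← h1]
      refine Finset.sum_congr rfl fun j _ => ?_
      simp only [Pi.add_apply]
      ring

/-- Multiplication of `a + ω b` by `ω²` shifts the blocks cyclically. -/
theorem isQuasiCyclic_cubicConstruction (hω : ω ^ 2 + ω + 1 = 0) :
    IsQuasiCyclic (cubicConstruction ω B D) := by
  rintro _ ⟨x, hx, a, b, hq, rfl⟩
  refine ⟨x, hx, a + b, a, ?_, ?_⟩
  · have h : quaternaryWord ω (a + b) a = (ω ^ 2) • quaternaryWord ω a b := by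
      rw [pow_two, mul_smul, omega_smul_quaternaryWord hω, omega_smul_quaternaryWord hω]
      congr 1
      funext j
      have key (e f : ZMod 2) : e = f + (e + f) := by revert e f; decide
      exact key _ _
    rw [h]
    exact D.smul_mem _ hq
  · funext ⟨i, j⟩
    have key (x a b : ZMod 2) : x + a + b = x + (a + b) ∧ x + b = x + (a + b) + a := by
      revert x a b; decide
    fin_cases i
    · exact (key (x j) (a j) (b j)).1
    · rfl
    · exact (key (x j) (a j) (b j)).2

/-- The number of common nonzero positions of two words. -/
noncomputable def overlap {ι K L : Type*} [Fintype ι] [Zero K] [Zero L] (x : ι → K) (q : ι → L) :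
    ℕ := {j | x j ≠ 0 ∧ q j ≠ 0}.ncard

theorem overlap_eq_sum {ι K L : Type*} [Fintype ι] [Zero K] [Zero L] [DecidableEq K]
    [DecidableEq L] (x : ι → K) (q : ι → L) :
    overlap x q = ∑ j, if x j ≠ 0 ∧ q j ≠ 0 then 1 else 0 := by
  rw [overlap, Set.ncard_eq_toFinset_card', Set.toFinset_ofPred, Finset.card_filter]

theorem overlap_le_left {ι K L : Type*} [Fintype ι] [Field K] [Zero L] (x : ι → K) (q : ι → L) :
    overlap x q ≤ wt x := by
  classical
  rw [overlap_eq_sum, wt_eq_sum]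
  refine Finset.sum_le_sum fun j _ => ?_
  split_ifs <;> simp_all

theorem overlap_le_right {ι K L : Type*} [Fintype ι] [Zero K] [Field L] (x : ι → K) (q : ι → L) :
    overlap x q ≤ wt q := by
  classical
  rw [overlap_eq_sum, wt_eq_sum]
  refine Finset.sum_le_sum fun j _ => ?_
  split_ifs <;> simp_all

theorem wt_add_wt_le {ι K L : Type*} [Fintype ι] [Field K] [Field L] (x : ι → K) (q : ι → L) :
    wt x + wt q ≤ Fintype.card ι + overlap x q := by
  classical
  rw [overlap_eq_sum, wt_eq_sum, wt_eq_sum, Fintype.card_eq_sum_ones, ← Finset.sum_add_distrib,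
    ← Finset.sum_add_distrib]
  refine Finset.sum_le_sum fun j _ => ?_
  split_ifs <;> simp_all

theorem wt_add_eq {ι : Type*} [Fintype ι] (x y : ι → ZMod 2) :
    wt (x + y) + 2 * overlap x y = wt x + wt y := by
  rw [overlap_eq_sum, wt_eq_sum, wt_eq_sum, wt_eq_sum, Finset.mul_sum, ← Finset.sum_add_distrib,
    ← Finset.sum_add_distrib]
  refine Finset.sum_congr rfl fun j _ => ?_
  have key (e f : ZMod 2) : (if e + f ≠ 0 then 1 else 0) + 2 * (if e ≠ 0 ∧ f ≠ 0 then 1 else 0)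
      = (if e ≠ 0 then 1 else 0) + if f ≠ 0 then 1 else 0 := by
    revert e f; decide
  exact key _ _

theorem sum_mul_eq_overlap {ι : Type*} [Fintype ι] (x y : ι → ZMod 2) :
    ∑ j, x j * y j = (overlap x y : ZMod 2) := by
  rw [overlap_eq_sum, Nat.cast_sum]
  refine Finset.sum_congr rfl fun j _ => ?_
  generalize x j = e
  generalize y j = f
  revert e f; decide

/-- A column of `(x + a | x + b | x + a + b)` has weight `3 x` where `a + ω b` vanishes and
`2 - x` elsewhere. -/
theorem wt_cubicWord (hω : ω ^ 2 + ω + 1 = 0) (x a b : Fin ℓ → ZMod 2) :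
    wt (cubicWord x a b) + 4 * overlap x (quaternaryWord ω a b)
      = 3 * wt x + 2 * wt (quaternaryWord ω a b) := by
  classical
  rw [overlap_eq_sum, wt_eq_sum, wt_eq_sum, wt_eq_sum, sum_block_prod, Finset.mul_sum,
    Finset.mul_sum, Finset.mul_sum, ← Finset.sum_add_distrib, ← Finset.sum_add_distrib]
  refine Finset.sum_congr rfl fun j _ => ?_
  simp only [ne_eq, quaternaryWord_apply_eq_zero hω]
  have key (x a b : ZMod 2) : (if ¬x + a = 0 then 1 else 0) + (if ¬x + b = 0 then 1 else 0)
      + (if ¬x + a + b = 0 then 1 else 0) + 4 * (if ¬x = 0 ∧ ¬(a = 0 ∧ b = 0) then 1 else 0)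
      = 3 * (if ¬x = 0 then 1 else 0) + 2 * if ¬(a = 0 ∧ b = 0) then 1 else 0 := by
    revert x a b; decide
  exact key _ _ _

end Cubic

/-! ### Weight enumerators of cubic codes of length 54 -/

section Length54

/-- The conditions on a binary and a quaternary code of length 18 under which the cubic
construction has minimum weight 10. The coset of `s` is the shadow of `B`. The last two conditions
exclude the pairs of words that would give words of weight 8, respectively 6 or 8. -/
structure IsExtremalPair (B : Submodule (ZMod 2) (Fin 18 → ZMod 2))
    (D : Submodule F4 (Fin 18 → F4)) (s : Fin 18 → ZMod 2) : Prop where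
  selfDual_left : IsEuclideanSelfDual B
  selfDual_right : IsHermitianSelfDual D
  shadow : ∀ x ∈ B, wt (s + x) % 4 = 1
  le_wt_left : ∀ x ∈ B, x ≠ 0 → 4 ≤ wt x
  le_wt_right : ∀ q ∈ D, q ≠ 0 → 6 ≤ wt q
  overlap_ne_four : ∀ x ∈ B, ∀ q ∈ D, wt x = 4 → wt q = 6 → overlap x q ≠ 4
  overlap_ne_wt : ∀ x ∈ B, ∀ q ∈ D, wt x = 6 ∨ wt x = 8 → wt q = wt x → overlap x q ≠ wt x

/-- The number of words of weight 1 in the coset of `s`. -/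
noncomputable def numUnits (B : Submodule (ZMod 2) (Fin 18 → ZMod 2)) (s : Fin 18 → ZMod 2) : ℕ :=
  {x | x ∈ B ∧ wt (s + x) = 1}.ncard

/-- The number of pairs of a word of weight 5 in the coset of `s` and a word of weight 6 of `D`
whose support contains it. -/
noncomputable def numPentads (B : Submodule (ZMod 2) (Fin 18 → ZMod 2))
    (D : Submodule F4 (Fin 18 → F4)) (s : Fin 18 → ZMod 2) : ℕ :=
  {p : (Fin 18 → ZMod 2) × (Fin 18 → F4) | (p.1 ∈ B ∧ p.2 ∈ D) ∧
    wt (s + p.1) = 5 ∧ wt p.2 = 6 ∧ overlap (s + p.1) p.2 = 5}.ncard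

variable {ω : F4} {B : Submodule (ZMod 2) (Fin 18 → ZMod 2)} {D : Submodule F4 (Fin 18 → F4)}
  {s : Fin 18 → ZMod 2}

namespace IsExtremalPair

theorem shadow_zero (h : IsExtremalPair B D s) : wt s % 4 = 1 := by
  simpa using h.shadow 0 B.zero_mem

theorem wt_left (h : IsExtremalPair B D s) {x : Fin 18 → ZMod 2} (hx : x ∈ B) :
    wt x % 4 = 2 * overlap s x % 4 := by
  have h0 := h.shadow_zero
  have h1 := h.shadow x hx
  have h2 := wt_add_eq s x
  omega

theorem wt_left_cases (h : IsExtremalPair B D s) {x : Fin 18 → ZMod 2} (hx : x ∈ B) :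
    (wt x = 0 ∨ 4 ≤ wt x) ∧ wt x % 2 = 0 := by
  refine ⟨?_, by have := h.wt_left hx; omega⟩
  by_cases h0 : x = 0
  · exact .inl (wt_eq_zero.2 h0)
  · exact .inr (h.le_wt_left x hx h0)

theorem wt_right_cases (h : IsExtremalPair B D s) {q : Fin 18 → F4} (hq : q ∈ D) :
    (wt q = 0 ∨ 6 ≤ wt q) ∧ wt q % 2 = 0 := by
  refine ⟨?_, Nat.even_iff.1 (h.selfDual_right.even_wt hq)⟩
  by_cases h0 : q = 0
  · exact .inl (wt_eq_zero.2 h0)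
  · exact .inr (h.le_wt_right q hq h0)

theorem selfDual (h : IsExtremalPair B D s) (hω : ω ^ 2 + ω + 1 = 0) :
    IsEuclideanSelfDual (cubicConstruction ω B D) :=
  isEuclideanSelfDual_cubicConstruction hω h.selfDual_left h.selfDual_right

theorem finrank (h : IsExtremalPair B D s) (hω : ω ^ 2 + ω + 1 = 0) :
    Module.finrank (ZMod 2) (cubicConstruction ω B D) = 27 := by
  have := (h.selfDual hω).two_mul_finrank
  simp only [Fintype.card_prod, Fintype.card_fin] at this
  omega

theorem even_wt (h : IsExtremalPair B D s) (hω : ω ^ 2 + ω + 1 = 0)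
    {c : Fin 3 × Fin 18 → ZMod 2} (hc : c ∈ cubicConstruction ω B D) : wt c % 2 = 0 := by
  obtain ⟨x, hx, a, b, hq, rfl⟩ := hc
  have h1 := wt_cubicWord hω x a b
  have h2 := h.wt_left_cases hx
  omega

theorem le_wt (h : IsExtremalPair B D s) (hω : ω ^ 2 + ω + 1 = 0)
    {c : Fin 3 × Fin 18 → ZMod 2} (hc : c ∈ cubicConstruction ω B D) (hc0 : c ≠ 0) :
    10 ≤ wt c := by
  have hpos : wt c ≠ 0 := fun h0 => hc0 (wt_eq_zero.1 h0)
  obtain ⟨x, hx, a, b, hq, rfl⟩ := hc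
  have h1 := wt_cubicWord hω x a b
  obtain ⟨h2, h2'⟩ := h.wt_left_cases hx
  obtain ⟨h3, h3'⟩ := h.wt_right_cases hq
  have h4 := overlap_le_left x (quaternaryWord ω a b)
  have h5 := overlap_le_right x (quaternaryWord ω a b)
  have h6 := h.overlap_ne_four x hx _ hq
  have h7 := h.overlap_ne_wt x hx _ hq
  have h8 := wt_add_wt_le x (quaternaryWord ω a b)
  rw [Fintype.card_fin] at h8
  omega

/-- The coset of `(s | s | s)` is the shadow of the cubic code. -/
theorem sgn_dot (h : IsExtremalPair B D s) (hω : ω ^ 2 + ω + 1 = 0)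
    {c : Fin 3 × Fin 18 → ZMod 2} (hc : c ∈ cubicConstruction ω B D) :
    sgn (∑ j, cubicWord s 0 0 j * c j) = (-1) ^ (wt c / 2) := by
  obtain ⟨x, hx, a, b, hq, rfl⟩ := hc
  have h1 := wt_cubicWord hω x a b
  have h2 := h.wt_left hx
  have h3 := h.wt_right_cases hq
  have hsgn (n : ℕ) : sgn (n : ZMod 2) = (-1) ^ n := by
    induction n with
    | zero => simp [sgn]
    | succ n ih => rw [Nat.cast_succ, sgn_add, ih, pow_succ]; rfl
  rw [sum_cubicWord_mul, sum_mul_eq_overlap]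
  simp only [Pi.zero_apply, zero_mul, add_zero, Finset.sum_const_zero, hsgn]
  apply neg_one_pow_congr
  rw [Nat.even_iff, Nat.even_iff]
  omega

/-- The weights in the shadow, and the origin of its words of weights 3 and 7. -/
theorem coset_wt (h : IsExtremalPair B D s) (hω : ω ^ 2 + ω + 1 = 0) {x a b : Fin 18 → ZMod 2}
    (hx : x ∈ B) (hq : quaternaryWord ω a b ∈ D) :
    wt (cubicWord s 0 0 + cubicWord x a b) % 4 = 3 ∧
    (wt (cubicWord s 0 0 + cubicWord x a b) = 3 ↔ wt (s + x) = 1 ∧ quaternaryWord ω a b = 0) ∧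
    (wt (cubicWord s 0 0 + cubicWord x a b) = 7 ↔ wt (s + x) = 5 ∧ wt (quaternaryWord ω a b) = 6 ∧
      overlap (s + x) (quaternaryWord ω a b) = 5) := by
  have h1 := wt_cubicWord hω (s + x) a b
  have h2 := h.shadow x hx
  obtain ⟨h3, h3'⟩ := h.wt_right_cases hq
  have h4 := overlap_le_left (s + x) (quaternaryWord ω a b)
  have h5 := overlap_le_right (s + x) (quaternaryWord ω a b)
  have h8 := wt_add_wt_le (s + x) (quaternaryWord ω a b)
  rw [Fintype.card_fin] at h8
  rw [cubicWord_add, zero_add, zero_add, ← wt_eq_zero (c := quaternaryWord ω a b)]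
  omega

theorem cosetNumWeight_eq_zero (h : IsExtremalPair B D s) (hω : ω ^ 2 + ω + 1 = 0) {i : ℕ}
    (hi : i % 4 ≠ 3) : cosetNumWeight (cubicConstruction ω B D) (cubicWord s 0 0) i = 0 := by
  rw [cosetNumWeight, Set.ncard_eq_zero, Set.eq_empty_iff_forall_notMem]
  rintro _ ⟨⟨x, hx, a, b, hq, rfl⟩, rfl⟩
  exact hi (h.coset_wt hω hx hq).1

theorem cosetNumWeight_three (h : IsExtremalPair B D s) (hω : ω ^ 2 + ω + 1 = 0) :
    cosetNumWeight (cubicConstruction ω B D) (cubicWord s 0 0) 3 = numUnits B s := by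
  have hzero : quaternaryWord ω (0 : Fin 18 → ZMod 2) 0 = 0 := by
    funext j; simp [quaternaryWord]
  have hz : quaternaryWord ω (0 : Fin 18 → ZMod 2) 0 ∈ D := by rw [hzero]; exact D.zero_mem
  symm
  refine Set.ncard_congr (fun x _ => cubicWord x 0 0) ?_ ?_ ?_
  · rintro x ⟨hx, hw⟩
    exact ⟨mem_cubicConstruction.2 ⟨hx, hz⟩, (h.coset_wt hω hx hz).2.1.2 ⟨hw, hzero⟩⟩
  · intro x y _ _ hxy
    exact (cubicWord_injective hxy).1
  · rintro _ ⟨⟨x, hx, a, b, hq, rfl⟩, hw⟩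
    obtain ⟨hw1, hq0⟩ := (h.coset_wt hω hx hq).2.1.1 hw
    obtain ⟨rfl, rfl⟩ := quaternaryWord_injective hω (hq0.trans hzero.symm)
    exact ⟨x, ⟨hx, hw1⟩, rfl⟩

theorem cosetNumWeight_seven (h : IsExtremalPair B D s) (hω : ω ^ 2 + ω + 1 = 0) :
    cosetNumWeight (cubicConstruction ω B D) (cubicWord s 0 0) 7 = numPentads B D s := by
  choose a b hab using exists_quaternaryWord (ℓ := 18) hω
  symm
  refine Set.ncard_congr (fun p _ => cubicWord p.1 (a p.2) (b p.2)) ?_ ?_ ?_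
  · rintro ⟨x, q⟩ ⟨⟨hx, hq⟩, hw⟩
    simp only at hx hq hw ⊢
    rw [hab q] at hq hw
    exact ⟨mem_cubicConstruction.2 ⟨hx, hq⟩, (h.coset_wt hω hx hq).2.2.2 hw⟩
  · rintro ⟨x, q⟩ ⟨x', q'⟩ _ _ hxy
    obtain ⟨h1, h2, h3⟩ := cubicWord_injective hxy
    refine Prod.ext h1 ?_
    simp only at h2 h3 ⊢
    rw [hab q, hab q', h2, h3]
  · rintro _ ⟨⟨x, hx, a', b', hq, rfl⟩, hw⟩
    refine ⟨(x, quaternaryWord ω a' b'), ⟨⟨hx, hq⟩, (h.coset_wt hω hx hq).2.2.1 hw⟩, ?_⟩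
    obtain ⟨h1, h2⟩ := quaternaryWord_injective hω (hab (quaternaryWord ω a' b'))
    simp only
    rw [← h1, ← h2]

/-- The all-one word lies in the code, so the weights of a coset are symmetric. -/
theorem cosetNumWeight_symm (h : IsExtremalPair B D s) (hω : ω ^ 2 + ω + 1 = 0) {i : ℕ}
    (hi : i ≤ 54) :
    cosetNumWeight (cubicConstruction ω B D) (cubicWord s 0 0) (54 - i)
      = cosetNumWeight (cubicConstruction ω B D) (cubicWord s 0 0) i := by
  have hself := h.selfDual hω
  have hone : (1 : Fin 3 × Fin 18 → ZMod 2) ∈ cubicConstruction ω B D := by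
    rw [hself]
    intro c hc
    have : overlap (1 : Fin 3 × Fin 18 → ZMod 2) c = wt c := by
      classical
      rw [overlap_eq_sum, wt_eq_sum]
      simp
    rw [sum_mul_eq_overlap, this]
    exact (ZMod.natCast_eq_zero_iff _ _).2 (Nat.dvd_of_mod_eq_zero (h.even_wt hω hc))
  have hcompl (c : Fin 3 × Fin 18 → ZMod 2) : wt (c + 1) + wt c = 54 := by
    classical
    have h54 : (54 : ℕ) = ∑ _j : Fin 3 × Fin 18, 1 := by simp
    rw [wt_eq_sum, wt_eq_sum, ← Finset.sum_add_distrib, h54]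
    refine Finset.sum_congr rfl fun j _ => ?_
    have key (e : ZMod 2) : (if e + 1 ≠ 0 then 1 else 0) + (if e ≠ 0 then 1 else 0) = 1 := by
      revert e; decide
    exact key _
  have hinv (c : Fin 3 × Fin 18 → ZMod 2) : c + 1 + 1 = c := by
    funext j
    simp only [Pi.add_apply, Pi.one_apply]
    generalize c j = e
    revert e; decide
  refine Set.ncard_congr (fun c _ => c + 1) ?_ ?_ ?_
  · rintro c ⟨hc, hw⟩
    refine ⟨Submodule.add_mem _ hc hone, ?_⟩
    have := hcompl (cubicWord s 0 0 + c)
    rw [add_assoc] at this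
    omega
  · intro c d _ _ hcd
    exact add_right_cancel hcd
  · rintro c ⟨hc, hw⟩
    refine ⟨c + 1, ⟨Submodule.add_mem _ hc hone, ?_⟩, hinv c⟩
    have := hcompl (cubicWord s 0 0 + c)
    rw [add_assoc] at this
    omega

theorem numWeight_zero (C : Submodule (ZMod 2) (Fin 3 × Fin 18 → ZMod 2)) : numWeight C 0 = 1 := by
  rw [numWeight, Set.ncard_eq_one]
  refine ⟨0, Set.eq_singleton_iff_unique_mem.2 ⟨⟨C.zero_mem, wt_zero⟩, ?_⟩⟩
  rintro c ⟨_, hc⟩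
  exact wt_eq_zero.1 hc

theorem numWeight_eq_zero (h : IsExtremalPair B D s) (hω : ω ^ 2 + ω + 1 = 0) {i : ℕ}
    (hi : 0 < i ∧ i < 10 ∨ i % 2 = 1) : numWeight (cubicConstruction ω B D) i = 0 := by
  rw [numWeight, Set.ncard_eq_zero, Set.eq_empty_iff_forall_notMem]
  rintro c ⟨hc, rfl⟩
  have h1 := h.even_wt hω hc
  have h2 := h.le_wt hω hc
  by_cases h0 : c = 0
  · rw [h0, wt_zero] at hi
    omega
  · have := h2 h0
    omega

/-- A linear combination, with coefficients `l`, of the equations for the numbers of words of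
weights `0, 2, 4, …`, in which the unknown numbers of words of the shadow cancel. Only the weights
3 and 7, and their complements 51 and 47, remain. -/
theorem numWeight_combination (h : IsExtremalPair B D s) (hω : ω ^ 2 + ω + 1 = 0) (l : Fin 8 → ℤ)
    (e₃ e₇ : ℤ) (hl : ∀ i < 28, i % 4 = 3 → ∑ w, l w * krawtchouk 54 (2 * w) i
      = if i = 3 then e₃ else if i = 7 then e₇ else 0)
    (hl' : ∀ i < 28, ∑ w, l w * krawtchouk 54 (2 * w) (54 - i)
      = ∑ w, l w * krawtchouk 54 (2 * w) i) :
    2 ^ 27 * ∑ w, l w * ((-1) ^ (w : ℕ) * numWeight (cubicConstruction ω B D) (2 * w))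
      = 2 * (numUnits B s * e₃ + numPentads B D s * e₇) := by
  set C := cubicConstruction ω B D with hC
  set b := cosetNumWeight C (cubicWord s 0 0) with hb
  set f : ℕ → ℤ := fun i => ∑ w, l w * krawtchouk 54 (2 * w) i with hf
  have hmain (w : Fin 8) : (2 : ℤ) ^ 27 * ((-1) ^ (w : ℕ) * numWeight C (2 * w))
      = ∑ i ∈ Finset.range 55, b i * krawtchouk 54 (2 * w) i := by
    have := two_pow_mul_numWeight (h.selfDual hω) (fun c hc => h.sgn_dot hω hc) (2 * w)
    rw [h.finrank hω, Nat.mul_div_cancel_left _ two_pos] at this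
    simpa using this
  have hsum : 2 ^ 27 * ∑ w, l w * ((-1) ^ (w : ℕ) * numWeight C (2 * w))
      = ∑ i ∈ Finset.range 55, b i * f i := by
    simp only [hf, Finset.mul_sum]
    rw [Finset.sum_comm]
    refine Finset.sum_congr rfl fun w _ => ?_
    rw [mul_left_comm, hmain, Finset.mul_sum]
    exact Finset.sum_congr rfl fun i _ => by ring
  have hzero (i : ℕ) (hi : i < 55) (h3 : i ≠ 3) (h7 : i ≠ 7) (h47 : i ≠ 47) (h51 : i ≠ 51) :
      (b i : ℤ) * f i = 0 := by
    by_cases h4 : i % 4 = 3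
    · have hf0 : f i = 0 := by
        by_cases hlt : i < 28
        · simp only [hf]
          rw [hl i hlt h4, if_neg h3, if_neg h7]
        · have h' := hl' (54 - i) (by omega)
          rw [show 54 - (54 - i) = i by omega] at h'
          simp only [hf]
          rw [h', hl (54 - i) (by omega) (by omega), if_neg (by omega), if_neg (by omega)]
      rw [hf0, mul_zero]
    · rw [hb, h.cosetNumWeight_eq_zero hω h4, Nat.cast_zero, zero_mul]
  have hsub : ({3, 7, 47, 51} : Finset ℕ) ⊆ Finset.range 55 := by decide
  rw [hsum, ← Finset.sum_subset hsub]
  · have hf3 : f 3 = e₃ := by simpa using hl 3 (by norm_num) (by norm_num)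
    have hf7 : f 7 = e₇ := by simpa using hl 7 (by norm_num) (by norm_num)
    have hf51 : f 51 = e₃ := (hl' 3 (by norm_num)).trans hf3
    have hf47 : f 47 = e₇ := (hl' 7 (by norm_num)).trans hf7
    have hb51 : b 51 = b 3 := h.cosetNumWeight_symm hω (i := 3) (by norm_num)
    have hb47 : b 47 = b 7 := h.cosetNumWeight_symm hω (i := 7) (by norm_num)
    have hb3 : b 3 = numUnits B s := h.cosetNumWeight_three hω
    have hb7 : b 7 = numPentads B D s := h.cosetNumWeight_seven hω
    simp only [Finset.sum_insert, Finset.mem_insert, Finset.mem_singleton, Finset.sum_singleton,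
      hf3, hf7, hf51, hf47, hb51, hb47, hb3, hb7, Nat.reduceEqDiff, or_self, not_false_eq_true]
    ring
  · intro i hi hni
    simp only [Finset.mem_insert, Finset.mem_singleton, not_or] at hni
    exact hzero i (Finset.mem_range.1 hi) hni.1 hni.2.1 hni.2.2.1 hni.2.2.2

/-- The shadow determines the first terms of the weight enumerator. -/
theorem numWeight_eq (h : IsExtremalPair B D s) (hω : ω ^ 2 + ω + 1 = 0) :
    (numWeight (cubicConstruction ω B D) 10 : ℤ)
      = 351 - 8 * (numPentads B D s + 12 * numUnits B s) ∧
    (numWeight (cubicConstruction ω B D) 12 : ℤ)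
      = 5031 + 24 * (numPentads B D s + 12 * numUnits B s) + 512 * numUnits B s ∧
    (numWeight (cubicConstruction ω B D) 14 : ℤ)
      = 48492 + 32 * (numPentads B D s + 12 * numUnits B s) - 4608 * numUnits B s := by
  -- For each weight the coefficients solve a linear system of five equations, which say that the
  -- numbers of shadow words of weights 11, 15, 19, 23 and 27 cancel.
  have h10 := h.numWeight_combination hω ![351, -91, 47, -3, 3, 1, 0, 0] 6442450944 536870912
    (by decide +kernel) (by decide +kernel)
  have h12 := h.numWeight_combination hω ![-5031, 1599, -331, 75, 5, 0, 1, 0] 53687091200 1610612736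
    (by decide +kernel) (by decide +kernel)
  have h14 := h.numWeight_combination hω ![48492, -10736, 1616, -132, -23, 0, 0, 1] 283467841536
    (-2147483648) (by decide +kernel) (by decide +kernel)
  have h0 := numWeight_zero (cubicConstruction ω B D)
  have h2 := h.numWeight_eq_zero hω (i := 2) (by norm_num)
  have h4 := h.numWeight_eq_zero hω (i := 4) (by norm_num)
  have h6 := h.numWeight_eq_zero hω (i := 6) (by norm_num)
  have h8 := h.numWeight_eq_zero hω (i := 8) (by norm_num)
  simp [Fin.sum_univ_succ, Fin.succ, h0, h2, h4, h6, h8] at h10 h12 h14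
  refine ⟨?_, ?_, ?_⟩ <;> linarith

theorem hasEnumerator_of_coeff (h : IsExtremalPair B D s) (hω : ω ^ 2 + ω + 1 = 0) {W : ℤ[X]}
    (hW : ∀ i ≤ 15, W.coeff i = if i = 0 then 1 else
      if i = 10 then (numWeight (cubicConstruction ω B D) 10 : ℤ) else
      if i = 12 then (numWeight (cubicConstruction ω B D) 12 : ℤ) else
      if i = 14 then (numWeight (cubicConstruction ω B D) 14 : ℤ) else 0) :
    HasEnumerator (cubicConstruction ω B D) W := by
  intro i hi
  rw [coeff_weightEnumerator _ (by simp; omega), hW i hi]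
  split_ifs with h0 h10 h12 h14
  · rw [h0, numWeight_zero]; rfl
  · rw [h10]
  · rw [h12]
  · rw [h14]
  · rw [h.numWeight_eq_zero hω (by omega), Nat.cast_zero]

theorem hasEnumerator_W₁ (h : IsExtremalPair B D s) (hω : ω ^ 2 + ω + 1 = 0)
    (hs : numUnits B s = 0) : HasEnumerator (cubicConstruction ω B D) (W₁ (numPentads B D s)) := by
  obtain ⟨h10, h12, h14⟩ := h.numWeight_eq hω
  rw [hs] at h10 h12 h14
  refine h.hasEnumerator_of_coeff hω fun i hi => ?_
  rw [h10, h12, h14, W₁]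
  simp only [coeff_add, coeff_C_mul, coeff_X_pow, coeff_one]
  split_ifs <;> omega

theorem hasEnumerator_W₂ (h : IsExtremalPair B D s) (hω : ω ^ 2 + ω + 1 = 0)
    (hs : numUnits B s = 1) :
    HasEnumerator (cubicConstruction ω B D) (W₂ (numPentads B D s + 12)) := by
  obtain ⟨h10, h12, h14⟩ := h.numWeight_eq hω
  rw [hs] at h10 h12 h14
  refine h.hasEnumerator_of_coeff hω fun i hi => ?_
  rw [h10, h12, h14, W₂]
  simp only [coeff_add, coeff_C_mul, coeff_X_pow, coeff_one]
  split_ifs <;> omega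

end IsExtremalPair

end Length54

/-! ### Words as bit masks -/

section Masks

/-- The binary word whose coordinates are the 18 lowest bits of `n`. -/
def word (n : ℕ) : Fin 18 → ZMod 2 := fun j => if n.testBit j then 1 else 0

/-- The quaternary word `a + ω b`, where `a` and `b` are given by the bits `0, …, 17` and
`18, …, 35` of `n`. -/
noncomputable def qword (ω : F4) (n : ℕ) : Fin 18 → F4 :=
  quaternaryWord ω (word n) (word (n >>> 18))

/-- The hexadecimal digits of this number are the numbers of one bits of `63, …, 0`. -/
def popTable : ℕ := 0x6554544354434332544343324332322154434332433232214332322132212110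

/-- The number of one bits among the 18 lowest bits. -/
def pop (n : ℕ) : ℕ :=
  popTable >>> (4 * (n % 64)) % 16 + popTable >>> (4 * (n / 64 % 64)) % 16
    + popTable >>> (4 * (n / 4096 % 64)) % 16

/-- The mask of the support of `qword ω n`. -/
def supp (n : ℕ) : ℕ := (n ||| n >>> 18) % 2 ^ 18

/-- Multiplication by `ω` on masks: `ω (a + ω b) = b + ω (a + b)`. -/
def omegaMul (n : ℕ) : ℕ := (n >>> 18) % 2 ^ 18 ||| ((n ^^^ n >>> 18) % 2 ^ 18) <<< 18

theorem word_zero : word 0 = 0 := by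
  funext j; simp [word]

theorem word_xor (m n : ℕ) : word (m ^^^ n) = word m + word n := by
  funext j
  simp only [word, Nat.testBit_xor, Pi.add_apply]
  cases m.testBit j <;> cases n.testBit j <;> decide

theorem word_apply_ne_zero (n : ℕ) (j : Fin 18) : word n j ≠ 0 ↔ n.testBit j = true := by
  simp [word]

theorem word_two_pow (i : Fin 18) : word (2 ^ (i : ℕ)) = Pi.single i 1 := by
  funext j
  rw [word, Nat.testBit_two_pow, Pi.single_apply]
  simp [Fin.ext_iff, eq_comm]

theorem wt_word (n : ℕ) : wt (word n) = pop n := by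
  have htable : ∀ m < 64,
      popTable >>> (4 * m) % 16 = ∑ i : Fin 6, if m.testBit i then 1 else 0 := by
    decide +kernel
  have hbit (k i : ℕ) (hi : i < 6) : (n / 2 ^ k % 64).testBit i = n.testBit (k + i) := by
    rw [show (64 : ℕ) = 2 ^ 6 by norm_num, Nat.testBit_mod_two_pow, Nat.testBit_div_two_pow]
    simp [hi, add_comm]
  have h0 := htable (n / 2 ^ 0 % 64) (Nat.mod_lt _ (by norm_num))
  have h1 := htable (n / 2 ^ 6 % 64) (Nat.mod_lt _ (by norm_num))
  have h2 := htable (n / 2 ^ 12 % 64) (Nat.mod_lt _ (by norm_num))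
  simp only [hbit _ _ (Fin.is_lt _)] at h0 h1 h2
  rw [pow_zero, Nat.div_one] at h0
  rw [show (2 : ℕ) ^ 6 = 64 by norm_num] at h1
  rw [show (2 : ℕ) ^ 12 = 4096 by norm_num] at h2
  rw [pop, h0, h1, h2, wt_eq_sum]
  simp only [word_apply_ne_zero]
  rw [Fin.sum_univ_eq_sum_range (fun i => if n.testBit i = true then 1 else 0) 18,
    Fin.sum_univ_eq_sum_range (fun i => if n.testBit (0 + i) = true then 1 else 0) 6,
    Fin.sum_univ_eq_sum_range (fun i => if n.testBit (6 + i) = true then 1 else 0) 6,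
    Fin.sum_univ_eq_sum_range (fun i => if n.testBit (12 + i) = true then 1 else 0) 6]
  simp only [Finset.sum_range_succ, Finset.sum_range_zero, Nat.reduceAdd]
  ring

theorem overlap_word (m n : ℕ) : overlap (word m) (word n) = pop (m &&& n) := by
  rw [← wt_word, overlap_eq_sum, wt_eq_sum]
  simp only [word_apply_ne_zero, Nat.testBit_and, Bool.and_eq_true]

theorem qword_xor (ω : F4) (m n : ℕ) : qword ω (m ^^^ n) = qword ω m + qword ω n := by
  rw [qword, Nat.shiftRight_xor_distrib, word_xor, word_xor, quaternaryWord_add]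
  rfl

variable {ω : F4} (hω : ω ^ 2 + ω + 1 = 0)
include hω

theorem qword_omegaMul (n : ℕ) : qword ω (omegaMul n) = ω • qword ω n := by
  rw [qword, qword, omega_smul_quaternaryWord hω, ← word_xor]
  congr 1
  · funext j
    simp only [word, omegaMul, Nat.testBit_or, Nat.testBit_shiftLeft, Nat.testBit_mod_two_pow]
    simp [Nat.not_le.2 j.2]
  · funext j
    simp only [word, omegaMul, Nat.testBit_or, Nat.testBit_shiftLeft, Nat.testBit_mod_two_pow,
      Nat.testBit_shiftRight, Nat.testBit_xor]
    simp

theorem qword_apply_ne_zero (n : ℕ) (j : Fin 18) : qword ω n j ≠ 0 ↔ word (supp n) j ≠ 0 := by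
  rw [Ne, qword, quaternaryWord_apply_eq_zero hω, word_apply_ne_zero, supp]
  simp only [word, Nat.testBit_mod_two_pow, Nat.testBit_or]
  simp only [Fin.is_lt, decide_true, Bool.true_and, Bool.or_eq_true, Nat.testBit_shiftRight]
  simp
  cases n.testBit j <;> simp

end Masks

/-! ### Support and proportionality -/

section Supports

theorem wt_congr {ι K L : Type*} [Fintype ι] [Field K] [Field L] {q : ι → K} {r : ι → L}
    (h : ∀ j, q j ≠ 0 ↔ r j ≠ 0) : wt q = wt r := by
  classical
  rw [wt_eq_sum, wt_eq_sum]
  simp only [h]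

theorem overlap_congr {ι K L M : Type*} [Fintype ι] [Zero K] [Zero L] [Zero M] (x : ι → K)
    {q : ι → L} {r : ι → M} (h : ∀ j, q j ≠ 0 ↔ r j ≠ 0) : overlap x q = overlap x r := by
  simp only [overlap, h]

theorem overlap_comp_perm {ι K L : Type*} [Fintype ι] [Zero K] [Zero L] (x : ι → K) (q : ι → L)
    (σ : Equiv.Perm ι) : overlap (fun j => x (σ j)) (fun j => q (σ j)) = overlap x q := by
  classical
  rw [overlap_eq_sum, overlap_eq_sum]
  exact Equiv.sum_comp σ fun j => if x j ≠ 0 ∧ q j ≠ 0 then 1 else 0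

theorem ne_zero_of_overlap_eq_wt {ι K L : Type*} [Fintype ι] [Field K] [Zero L] {x : ι → K}
    {q : ι → L} (h : overlap x q = wt x) {j : ι} (hj : x j ≠ 0) : q j ≠ 0 := by
  classical
  rw [overlap, Set.ncard_eq_toFinset_card', Set.toFinset_ofPred, wt_eq_card] at h
  have hsub : (Finset.univ.filter fun j => x j ≠ 0 ∧ q j ≠ 0) ⊆ Finset.univ.filter (x · ≠ 0) :=
    fun j => by simp +contextual
  have := Finset.eq_of_subset_of_card_le hsub h.ge
  have hm : j ∈ Finset.univ.filter (x · ≠ 0) := by simpa using hj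
  rw [← this] at hm
  exact (Finset.mem_filter.1 hm).2.2

theorem add_self_eq_zero_zmod_two {ι : Type*} (x : ι → ZMod 2) : x + x = 0 := by
  funext j
  have key (e : ZMod 2) : e + e = 0 := by revert e; decide
  exact key _

theorem eq_add_of_add_eq {ι : Type*} {x y z : ι → ZMod 2} (h : x + y = z) : y = x + z := by
  rw [← h, ← add_assoc, add_self_eq_zero_zmod_two, zero_add]

theorem exists_eq_single_of_wt_eq_one {ι : Type*} [Fintype ι] [DecidableEq ι] {x : ι → ZMod 2}
    (h : wt x = 1) : ∃ i, x = Pi.single i 1 := by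
  rw [wt_eq_card, Finset.card_eq_one] at h
  obtain ⟨i, hi⟩ := h
  refine ⟨i, funext fun j => ?_⟩
  have hj : x j ≠ 0 ↔ j = i := by simpa using Finset.ext_iff.1 hi j
  rw [Pi.single_apply]
  split_ifs with hji
  · exact (zmod_two_eq _).resolve_left (hj.2 hji)
  · exact not_not.1 fun h0 => hji (hj.1 h0)

theorem exists_eq_single_add_single_of_wt_eq_two {ι : Type*} [Fintype ι] [DecidableEq ι]
    {x : ι → ZMod 2} (h : wt x = 2) :
    ∃ i k, x i ≠ 0 ∧ x k ≠ 0 ∧ x = Pi.single i 1 + Pi.single k 1 := by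
  rw [wt_eq_card, Finset.card_eq_two] at h
  obtain ⟨i, k, hik, hi⟩ := h
  have hj (j) : x j ≠ 0 ↔ j = i ∨ j = k := by simpa using Finset.ext_iff.1 hi j
  refine ⟨i, k, (hj i).2 (.inl rfl), (hj k).2 (.inr rfl), funext fun j => ?_⟩
  rw [Pi.add_apply, Pi.single_apply, Pi.single_apply]
  have hj := hj j
  rcases zmod_two_eq (x j) with h0 | h1
  · rw [h0] at hj ⊢
    simp only [ne_eq, not_true_eq_false, false_iff, not_or] at hj
    simp [hj.1, hj.2]
  · rw [h1] at hj ⊢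
    simp only [ne_eq, one_ne_zero, not_false_eq_true, true_iff] at hj
    rcases hj with rfl | rfl
    · simp [hik]
    · simp [hik.symm]

/-- Two words of minimum weight with the same support are proportional. -/
theorem exists_smul_eq_of_support_eq {ι K : Type*} [Fintype ι] [Field K]
    {C : Submodule K (ι → K)} {d : ℕ} (hd : 0 < d) (hmin : ∀ c ∈ C, c ≠ 0 → d ≤ wt c)
    {c c' : ι → K} (hc : c ∈ C) (hc' : c' ∈ C) (hw : wt c = d) (h : ∀ j, c j ≠ 0 ↔ c' j ≠ 0) :
    ∃ r : Kˣ, c = r • c' := by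
  classical
  obtain ⟨i, hi⟩ : ∃ i, c i ≠ 0 := by
    by_contra! h0
    have : c = 0 := funext h0
    rw [this, wt_zero] at hw
    omega
  have hi' := (h i).1 hi
  refine ⟨Units.mk0 (c i / c' i) (div_ne_zero hi hi'), ?_⟩
  by_contra hne
  set z := c - (c i / c' i) • c' with hz
  have hz0 : z ≠ 0 := fun h0 => hne (sub_eq_zero.1 h0)
  have hle := hmin z (C.sub_mem hc (C.smul_mem _ hc')) hz0
  have hlt : wt z < wt c := by
    rw [wt_eq_card, wt_eq_card]
    refine Finset.card_lt_card ((Finset.ssubset_iff_of_subset ?_).2 ⟨i, by simpa using hi, ?_⟩)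
    · intro j hj
      simp only [Finset.mem_filter, Finset.mem_univ, true_and] at hj ⊢
      intro h0
      have h0' : c' j = 0 := not_not.1 fun hn => (h j).2 hn h0
      simp [hz, h0, h0'] at hj
    · simp [hz, hi']
  omega

end Supports

/-! ### Codes spanned by masks -/

section Span

/-- The binary code spanned by a list of masks. -/
def binaryCode (rs : List ℕ) : Submodule (ZMod 2) (Fin 18 → ZMod 2) :=
  Submodule.span (ZMod 2) (word '' {r | r ∈ rs})

/-- The quaternary code spanned by a list of masks. -/
noncomputable def quaternaryCode (ω : F4) (rs : List ℕ) : Submodule F4 (Fin 18 → F4) :=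
  Submodule.span F4 (qword ω '' {r | r ∈ rs})

theorem setOf_mem_cons {α : Type*} (g : α) (gs : List α) :
    {r | r ∈ g :: gs} = insert g {r | r ∈ gs} := by
  ext; simp

theorem mem_euclideanDual_span {ι K : Type*} [Fintype ι] [Field K] {S : Set (ι → K)} {u : ι → K} :
    u ∈ euclideanDual (Submodule.span K S) ↔ ∀ v ∈ S, ∑ j, u j * v j = 0 := by
  refine ⟨fun h v hv => h v (Submodule.subset_span hv), fun h v hv => ?_⟩
  induction hv using Submodule.span_induction with
  | mem v hv => exact h v hv
  | zero => simp
  | add v w _ _ hv hw => simp [mul_add, Finset.sum_add_distrib, hv, hw]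
  | smul r v _ hv => simp [mul_left_comm _ r, ← Finset.mul_sum, hv]

theorem mem_hermitianDual_span {ι : Type*} [Fintype ι] {S : Set (ι → F4)} {u : ι → F4} :
    u ∈ hermitianDual (Submodule.span F4 S) ↔ ∀ v ∈ S, ∑ j, u j * v j ^ 2 = 0 := by
  refine ⟨fun h v hv => h v (Submodule.subset_span hv), fun h v hv => ?_⟩
  induction hv using Submodule.span_induction with
  | mem v hv => exact h v hv
  | zero => simp
  | add v w _ _ hv hw => simp [CharTwo.add_sq, mul_add, Finset.sum_add_distrib, hv, hw]
  | smul r v _ hv => simp [mul_pow, mul_left_comm _ (r ^ 2), ← Finset.mul_sum, hv]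

/-- A code with a systematic family of nine words has dimension at least nine. -/
theorem nine_le_finrank {K : Type*} [Field K] {C : Submodule K (Fin 18 → K)}
    {v : Fin 9 → Fin 18 → K} (hv : ∀ i, v i ∈ C)
    (hsys : ∀ i j, v i (Fin.castLE (by norm_num) j) = if i = j then 1 else 0) :
    9 ≤ Module.finrank K C := by
  have hli : LinearIndependent K fun i => (⟨v i, hv i⟩ : C) := by
    rw [Fintype.linearIndependent_iff]
    intro g hg j
    have h := congrFun (congrArg C.subtype hg) (Fin.castLE (by norm_num) j)
    simpa [hsys] using h
  simpa using hli.fintype_card_le_finrank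

/-- The word of a mask is orthogonal to all words of a list of masks. -/
def orth (rs : List ℕ) (m : ℕ) : Bool := rs.all fun r => pop (m &&& r) % 2 == 0

theorem dot_word (m n : ℕ) : ∑ j, word m j * word n j = 0 ↔ pop (m &&& n) % 2 = 0 := by
  rw [sum_mul_eq_overlap, overlap_word, ZMod.natCast_eq_zero_iff, Nat.dvd_iff_mod_eq_zero]

theorem orth_iff {rs : List ℕ} {m : ℕ} :
    orth rs m = true ↔ ∀ r ∈ rs, ∑ j, word m j * word r j = 0 := by
  simp only [orth, List.all_eq_true, beq_iff_eq, dot_word]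

/-- The Hermitian product of two masks vanishes. -/
def hermOrth (m n : ℕ) : Bool :=
  (pop (m &&& n) + pop (m >>> 18 &&& n >>> 18) + pop (m &&& n >>> 18)) % 2 == 0 &&
    (pop (m &&& n >>> 18) + pop (m >>> 18 &&& n)) % 2 == 0

theorem sum_qword_mul_sq {ω : F4} (hω : ω ^ 2 + ω + 1 = 0) {m n : ℕ} (h : hermOrth m n = true) :
    ∑ j, qword ω m j * qword ω n j ^ 2 = 0 := by
  simp only [hermOrth, Bool.and_eq_true, beq_iff_eq] at h
  rw [qword, qword, sum_quaternaryWord_mul_sq hω, coord_eq_zero_iff hω]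
  simp only [Finset.sum_add_distrib, sum_mul_eq_overlap, overlap_word, ← Nat.cast_add]
  rw [ZMod.natCast_eq_zero_iff, ZMod.natCast_eq_zero_iff]
  exact ⟨Nat.dvd_of_mod_eq_zero h.1, Nat.dvd_of_mod_eq_zero h.2⟩

/-- The first nine columns of the nine masks form the identity matrix. -/
def isSystematic (rs : List ℕ) : Bool :=
  rs.length == 9 && (List.range 9).all fun i => rs.getD i 0 % 512 == 2 ^ i &&
    rs.getD i 0 >>> 18 % 512 == 0

theorem word_systematic {rs : List ℕ} (h : isSystematic rs = true) (i j : Fin 9) :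
    word (rs.getD i 0) (Fin.castLE (by norm_num) j) = (if i = j then 1 else 0) ∧
    word (rs.getD i 0 >>> 18) (Fin.castLE (by norm_num) j) = 0 := by
  simp only [isSystematic, Bool.and_eq_true, beq_iff_eq, List.all_eq_true, List.mem_range] at h
  obtain ⟨h1, h2⟩ := h.2 i i.2
  have hb (n : ℕ) : n.testBit j = (n % 2 ^ 9).testBit j := by
    rw [Nat.testBit_mod_two_pow]; simp
  constructor
  · rw [word, Fin.val_castLE, hb, show (2 : ℕ) ^ 9 = 512 by norm_num, h1, Nat.testBit_two_pow]
    simp [Fin.ext_iff]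
  · rw [word, Fin.val_castLE, hb, show (2 : ℕ) ^ 9 = 512 by norm_num, h2]
    simp

theorem getD_mem {rs : List ℕ} (h : isSystematic rs = true) (i : Fin 9) : rs.getD i 0 ∈ rs := by
  simp only [isSystematic, Bool.and_eq_true, beq_iff_eq] at h
  have : (i : ℕ) < rs.length := by omega
  rw [List.getD_eq_getElem _ _ this]
  exact List.getElem_mem this

theorem isEuclideanSelfDual_binaryCode {rs : List ℕ} (hsys : isSystematic rs = true)
    (horth : rs.all (orth rs) = true) : IsEuclideanSelfDual (binaryCode rs) := by
  have hle : binaryCode rs ≤ euclideanDual (binaryCode rs) := by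
    refine Submodule.span_le.2 ?_
    rintro _ ⟨m, hm, rfl⟩
    refine mem_euclideanDual_span.2 ?_
    rintro _ ⟨n, hn, rfl⟩
    exact orth_iff.1 (List.all_eq_true.1 horth m hm) n hn
  have h9 : 9 ≤ Module.finrank (ZMod 2) (binaryCode rs) :=
    nine_le_finrank (fun i => Submodule.subset_span ⟨_, getD_mem hsys i, rfl⟩)
      fun i j => (word_systematic hsys i j).1
  refine isEuclideanSelfDual_of_le hle ?_
  have h1 := finrank_add_finrank_euclideanDual (binaryCode rs)
  have h2 := Submodule.finrank_mono hle
  rw [Fintype.card_fin] at h1 ⊢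
  omega

theorem isHermitianSelfDual_quaternaryCode {ω : F4} (hω : ω ^ 2 + ω + 1 = 0) {rs : List ℕ}
    (hsys : isSystematic rs = true) (horth : (rs.all fun m => rs.all (hermOrth m)) = true) :
    IsHermitianSelfDual (quaternaryCode ω rs) := by
  have hle : quaternaryCode ω rs ≤ hermitianDual (quaternaryCode ω rs) := by
    refine Submodule.span_le.2 ?_
    rintro _ ⟨m, hm, rfl⟩
    refine mem_hermitianDual_span.2 ?_
    rintro _ ⟨n, hn, rfl⟩
    exact sum_qword_mul_sq hω (List.all_eq_true.1 (List.all_eq_true.1 horth m hm) n hn)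
  have h9 : 9 ≤ Module.finrank F4 (quaternaryCode ω rs) := by
    refine nine_le_finrank (fun i => Submodule.subset_span ⟨_, getD_mem hsys i, rfl⟩)
      fun i j => ?_
    obtain ⟨h1, h2⟩ := word_systematic hsys i j
    rw [qword, quaternaryWord, h1, h2]
    split_ifs <;> simp
  refine isHermitianSelfDual_of_le hle ?_
  have h1 := finrank_add_finrank_hermitianDual (quaternaryCode ω rs)
  have h2 := Submodule.finrank_mono hle
  rw [Fintype.card_fin] at h1 ⊢
  omega

/-- The generators of a self-dual code are also its parity checks. -/
theorem mem_binaryCode_iff {rs : List ℕ} (h : IsEuclideanSelfDual (binaryCode rs))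
    {x : Fin 18 → ZMod 2} : x ∈ binaryCode rs ↔ ∀ r ∈ rs, ∑ j, x j * word r j = 0 := by
  conv_lhs => rw [h]
  rw [binaryCode, mem_euclideanDual_span]
  simp

end Span

/-! ### Exhaustive enumeration of codes -/

section Enumeration

/-- Continue with the value of a numeral. The case distinction makes the kernel evaluate `n` once,
instead of substituting the unevaluated expression into `f`. -/
def force {α : Sort*} (n : ℕ) (f : ℕ → α) : α := Nat.rec (f 0) (fun k _ => f (k + 1)) n

theorem force_eq {α : Sort*} (n : ℕ) (f : ℕ → α) : force n f = f n := by
  cases n <;> rfl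

/-- Continue with the values of a list of numerals. -/
def forceList {α : Sort*} : List ℕ → (List ℕ → α) → α
  | [], f => f []
  | n :: l, f => force n fun m => forceList l fun l' => f (m :: l')

theorem forceList_eq {α : Sort*} (l : List ℕ) (f : List ℕ → α) : forceList l f = f l := by
  induction l generalizing f with
  | nil => rfl
  | cons n l ih => rw [forceList, force_eq, ih]

/-- `p` holds for all masks in the coset of `n` of the binary span of a list. -/
def allBinary (p : ℕ → Bool) : List ℕ → ℕ → Bool
  | [], n => p n
  | g :: gs, n => allBinary p gs n && force (n ^^^ g) (allBinary p gs)

theorem exists_of_allBinary {p : ℕ → Bool} {rs : List ℕ} {n : ℕ} (h : allBinary p rs n = true)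
    {x : Fin 18 → ZMod 2} (hx : x ∈ binaryCode rs) : ∃ m, p m = true ∧ word n + x = word m := by
  induction rs generalizing n x with
  | nil =>
    have : x = 0 := by simpa [binaryCode] using hx
    exact ⟨n, h, by rw [this, add_zero]⟩
  | cons g gs ih =>
    rw [allBinary, Bool.and_eq_true, force_eq] at h
    rw [binaryCode, setOf_mem_cons, Set.image_insert_eq, Submodule.mem_span_insert] at hx
    obtain ⟨a, z, hz, rfl⟩ := hx
    rcases zmod_two_eq a with rfl | rfl
    · rw [zero_smul, zero_add]
      exact ih h.1 hz
    · rw [one_smul, ← add_assoc, ← word_xor]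
      exact ih h.2 hz

/-- `p` holds for all masks in the coset of `n` of the quaternary span of a list. -/
def allQuaternary (p : ℕ → Bool) : List ℕ → ℕ → Bool
  | [], n => p n
  | g :: gs, n => allQuaternary p gs n && force (n ^^^ g) (allQuaternary p gs) &&
      force (omegaMul g) fun w => force (n ^^^ w) (allQuaternary p gs) &&
        force (n ^^^ w ^^^ g) (allQuaternary p gs)

/-- `p` holds for all masks in the quaternary span of a list whose first nonzero coefficient
is 1. -/
def allNormalized (p : ℕ → Bool) : List ℕ → Bool
  | [] => true
  | g :: gs => allQuaternary p gs g && allNormalized p gs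

variable {ω : F4} (hω : ω ^ 2 + ω + 1 = 0)
include hω

theorem exists_of_allQuaternary {p : ℕ → Bool} {rs : List ℕ} {n : ℕ}
    (h : allQuaternary p rs n = true) {x : Fin 18 → F4} (hx : x ∈ quaternaryCode ω rs) :
    ∃ m, p m = true ∧ qword ω n + x = qword ω m := by
  induction rs generalizing n x with
  | nil =>
    have : x = 0 := by simpa [quaternaryCode] using hx
    exact ⟨n, h, by rw [this, add_zero]⟩
  | cons g gs ih =>
    simp only [allQuaternary, Bool.and_eq_true, force_eq] at h
    rw [quaternaryCode, setOf_mem_cons, Set.image_insert_eq, Submodule.mem_span_insert] at hx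
    obtain ⟨c, z, hz, rfl⟩ := hx
    obtain ⟨a, b, rfl⟩ := exists_coord hω c
    rcases zmod_two_eq a with rfl | rfl <;> rcases zmod_two_eq b with rfl | rfl
    · simpa using ih h.1.1 hz
    · have := ih h.2.1 hz
      rw [qword_xor, qword_omegaMul hω] at this
      simpa [add_assoc] using this
    · have := ih h.1.2 hz
      rw [qword_xor] at this
      simpa [add_assoc] using this
    · have := ih h.2.2 hz
      rw [qword_xor, qword_xor, qword_omegaMul hω] at this
      simpa [add_smul, add_assoc, add_left_comm] using this

theorem exists_of_allNormalized {p : ℕ → Bool} {rs : List ℕ} (h : allNormalized p rs = true)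
    {x : Fin 18 → F4} (hx : x ∈ quaternaryCode ω rs) (hx0 : x ≠ 0) :
    ∃ m, p m = true ∧ ∃ r : F4, r ≠ 0 ∧ r • x = qword ω m := by
  induction rs generalizing x with
  | nil => exact absurd (by simpa [quaternaryCode] using hx) hx0
  | cons g gs ih =>
    rw [allNormalized, Bool.and_eq_true] at h
    rw [quaternaryCode, setOf_mem_cons, Set.image_insert_eq, Submodule.mem_span_insert] at hx
    obtain ⟨c, z, hz, rfl⟩ := hx
    by_cases hc : c = 0
    · subst hc
      rw [zero_smul, zero_add] at hx0 ⊢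
      exact ih h.2 hz hx0
    · obtain ⟨m, hm, hq⟩ := exists_of_allQuaternary hω h.1 (Submodule.smul_mem _ c⁻¹ hz)
      refine ⟨m, hm, c⁻¹, inv_ne_zero hc, ?_⟩
      rw [smul_add, inv_smul_smul₀ hc, hq]

end Enumeration

/-! ### Permuted components -/

section Permuted

/-- The words whose coordinates, read in the order given by `σ`, form a word of `C`. -/
def permCode {ι K : Type*} [Fintype ι] [Field K] (σ : Equiv.Perm ι) (C : Submodule K (ι → K)) :
    Submodule K (ι → K) := C.comap (LinearMap.funLeft K K σ)

theorem mem_permCode {ι K : Type*} [Fintype ι] [Field K] {σ : Equiv.Perm ι}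
    {C : Submodule K (ι → K)} {d : ι → K} : d ∈ permCode σ C ↔ (fun j => d (σ j)) ∈ C := Iff.rfl

theorem permEquiv_permCode {ι K : Type*} [Fintype ι] [Field K] (σ : Equiv.Perm ι)
    (C : Submodule K (ι → K)) : PermEquiv C (permCode σ C) :=
  ⟨σ.symm, fun c => by rw [mem_permCode]; simp⟩

theorem isHermitianSelfDual_permCode {ι : Type*} [Fintype ι] (σ : Equiv.Perm ι)
    {C : Submodule F4 (ι → F4)} (h : IsHermitianSelfDual C) :
    IsHermitianSelfDual (permCode σ C) := by
  have hmem (v : ι → F4) : v ∈ C ↔ v ∈ hermitianDual C := by rw [← h]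
  ext u
  rw [mem_permCode, hmem]
  constructor
  · intro hu v hv
    rw [← Equiv.sum_comp σ]
    exact hu _ (mem_permCode.1 hv)
  · intro hu v hv
    have := hu (fun j => v (σ.symm j)) (by rw [mem_permCode]; simpa using hv)
    rw [← Equiv.sum_comp σ] at this
    simpa using this

/-- The mask whose bits are those of `r` in the order given by `f`. -/
def permMask (f : Fin 18 → Fin 18) (r : ℕ) : ℕ := Nat.ofBits fun j => r.testBit (f j)

theorem word_permMask (f : Fin 18 → Fin 18) (r : ℕ) :
    word (permMask f r) = fun j => word r (f j) := by
  funext j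
  rw [word, word, permMask, Nat.testBit_ofBits_lt _ _ j.2]

/-- Membership in the code is tested on masks, in the order of the coordinates given by `σ`. -/
theorem mem_binaryCode_iff_orth {rs : List ℕ} (h : IsEuclideanSelfDual (binaryCode rs))
    (σ : Equiv.Perm (Fin 18)) {x : Fin 18 → ZMod 2} {m : ℕ} (hx : (fun j => x (σ j)) = word m) :
    x ∈ binaryCode rs ↔ orth (rs.map (permMask σ)) m = true := by
  rw [mem_binaryCode_iff h, orth_iff]
  simp only [List.mem_map, forall_exists_index, and_imp, forall_apply_eq_imp_iff₂, word_permMask,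
    ← hx]
  refine forall₂_congr fun r _ => ?_
  rw [Equiv.sum_comp σ fun j => x j * word r j]

/-- No word of the code with parity checks `rs` is the support `S`, or `S` without two points. -/
def avoidsHexad (rs : List ℕ) (S : ℕ) : Bool :=
  !orth rs S && decide (∀ i : Fin 18, S.testBit i = true → ∀ k : Fin 18, S.testBit k = true →
    orth rs (S ^^^ 2 ^ (i : ℕ) ^^^ 2 ^ (k : ℕ)) = false)

/-- The number of points `i` of `S` such that `S` without `i` is in the coset of `s` of the code
with parity checks `rs`. -/
def pentadCount (rs : List ℕ) (s S : ℕ) : ℕ :=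
  (Finset.univ.filter fun i : Fin 18 =>
    (S.testBit i && orth rs (S ^^^ 2 ^ (i : ℕ) ^^^ s)) = true).card

/-- The conditions on a word of a quaternary code with support `S`: its weight is 6, 8 or at least
10, the supports of weight 6 are in `H`, and those of weight 8 are not words of any of the codes
with parity checks in `cs`. -/
def lowWeightCheck (H : List ℕ) (cs : List (List ℕ)) (n : ℕ) : Bool :=
  force (supp n) fun S => force (pop S) fun w =>
    Nat.ble 10 w || (w == 8 && cs.all fun rs => !orth rs S) || (w == 6 && H.contains S)

variable {ω : F4} (hω : ω ^ 2 + ω + 1 = 0)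
include hω

/-- Scaling does not change the support, so the check of the normalized words covers the code. -/
theorem exists_support {H : List ℕ} {cs : List (List ℕ)} {qs : List ℕ}
    (h : allNormalized (lowWeightCheck H cs) qs = true) {q : Fin 18 → F4}
    (hq : q ∈ quaternaryCode ω qs) (hq0 : q ≠ 0) :
    ∃ S, (∀ j, q j ≠ 0 ↔ word S j ≠ 0) ∧ wt q = pop S ∧
      (10 ≤ pop S ∨ (pop S = 8 ∧ ∀ rs ∈ cs, orth rs S = false) ∨ (pop S = 6 ∧ S ∈ H)) := by
  obtain ⟨m, hm, r, hr, hrq⟩ := exists_of_allNormalized hω h hq hq0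
  have hsupp (j) : q j ≠ 0 ↔ word (supp m) j ≠ 0 := by
    rw [← qword_apply_ne_zero hω, ← hrq]
    simp [hr]
  refine ⟨supp m, hsupp, by rw [← wt_word, wt_congr hsupp], ?_⟩
  simpa [lowWeightCheck, force_eq, Nat.ble_eq, or_assoc] using hm

/-- The quaternary code has minimum weight 6, and `hs` lists masks of words of weight 6, one for
each support. -/
structure IsHexadList (ω : F4) (qs hs : List ℕ) : Prop where
  le_wt : ∀ q ∈ quaternaryCode ω qs, q ≠ 0 → 6 ≤ wt q
  exists_mem : ∀ q ∈ quaternaryCode ω qs, wt q = 6 →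
    ∃ n ∈ hs, ∀ j, q j ≠ 0 ↔ word (supp n) j ≠ 0
  mem : ∀ n ∈ hs, qword ω n ∈ quaternaryCode ω qs
  pop_eq : ∀ n ∈ hs, pop (supp n) = 6
  nodup : (hs.map supp).Nodup

theorem IsHexadList.wt_eq {qs hs : List ℕ} (h : IsHexadList ω qs hs) {n : ℕ} (hn : n ∈ hs) :
    wt (qword ω n) = 6 := by
  rw [wt_congr (qword_apply_ne_zero hω n), wt_word, h.pop_eq n hn]

/-- Each support of weight 6 belongs to three words, the nonzero multiples of one of them. -/
theorem IsHexadList.sum_eq {qs hs : List ℕ} (h : IsHexadList ω qs hs)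
    (g : (Fin 18 → F4) → ℕ) (hg : ∀ (r : F4ˣ) q, g (r • q) = g q) {T : Finset (Fin 18 → F4)}
    (hT : ∀ q, q ∈ T ↔ q ∈ quaternaryCode ω qs ∧ wt q = 6) :
    ∑ q ∈ T, g q = 3 * (hs.map fun n => g (qword ω n)).sum := by
  classical
  have := Fintype.ofFinite F4ˣ
  have hwt (r : F4ˣ) (q : Fin 18 → F4) : wt (r • q) = wt q :=
    wt_congr fun j => by simp [Units.smul_def]
  have hcard : Fintype.card F4ˣ = 3 := by
    rw [← Nat.card_eq_fintype_card, Nat.card_units, GaloisField.card 2 2 (by norm_num)]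
    norm_num
  have himage : T = (hs.toFinset ×ˢ (Finset.univ : Finset F4ˣ)).image
      fun p => p.2 • qword ω p.1 := by
    ext q
    simp only [hT, Finset.mem_image, Finset.mem_product, List.mem_toFinset, Finset.mem_univ,
      and_true, Prod.exists]
    constructor
    · rintro ⟨hq, hw⟩
      obtain ⟨n, hn, hs'⟩ := h.exists_mem q hq hw
      obtain ⟨r, hr⟩ := exists_smul_eq_of_support_eq (by norm_num) h.le_wt hq (h.mem n hn) hw
        fun j => (hs' j).trans (qword_apply_ne_zero hω n j).symm
      exact ⟨n, r, hn, hr.symm⟩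
    · rintro ⟨n, r, hn, rfl⟩
      exact ⟨Submodule.smul_mem _ (r : F4) (h.mem n hn), by rw [hwt, h.wt_eq hω hn]⟩
  have hinj : Set.InjOn (fun p : ℕ × F4ˣ => p.2 • qword ω p.1)
      (hs.toFinset ×ˢ (Finset.univ : Finset F4ˣ) : Finset (ℕ × F4ˣ)) := by
    rintro ⟨n, r⟩ hn ⟨n', r'⟩ hn' heq
    simp only [Finset.coe_product, Set.mem_prod, Finset.mem_coe, List.mem_toFinset,
      Finset.mem_univ, and_true] at hn hn' heq
    have hsupp : supp n = supp n' := by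
      refine Nat.eq_of_testBit_eq fun i => ?_
      by_cases hi : i < 18
      · have hj := qword_apply_ne_zero hω n ⟨i, hi⟩
        have hj' := qword_apply_ne_zero hω n' ⟨i, hi⟩
        have hc := congrFun heq ⟨i, hi⟩
        rw [word_apply_ne_zero] at hj hj'
        rw [Bool.eq_iff_iff, ← hj, ← hj']
        constructor
        · intro h1 h2
          refine h1 ?_
          simpa [h2, Units.smul_def] using hc
        · intro h1 h2
          refine h1 ?_
          simpa [h2, Units.smul_def, eq_comm] using hc
      · rw [supp, supp, Nat.testBit_mod_two_pow, Nat.testBit_mod_two_pow]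
        simp [hi]
    obtain rfl : n = n' := List.inj_on_of_nodup_map h.nodup hn hn' hsupp
    obtain ⟨j, hj⟩ : ∃ j, qword ω n j ≠ 0 := by
      by_contra! h0
      have h1 := h.wt_eq hω hn
      rw [show qword ω n = 0 from funext h0, wt_zero] at h1
      omega
    have hc := congrFun heq j
    simp only [Pi.smul_apply, Units.smul_def, smul_eq_mul] at hc
    exact Prod.ext rfl (Units.ext (mul_right_cancel₀ hj hc))
  have hnodup : hs.Nodup := List.Nodup.of_map _ h.nodup
  rw [himage, Finset.sum_image hinj, Finset.sum_product]
  simp only [hg, Finset.sum_const, Finset.card_univ, hcard, smul_eq_mul]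
  rw [← Finset.mul_sum, List.sum_toFinset _ hnodup]

theorem IsHexadList.numWeight_six {qs hs : List ℕ} (h : IsHexadList ω qs hs) :
    numWeight (quaternaryCode ω qs) 6 = 3 * hs.length := by
  classical
  have hfin : {c : Fin 18 → F4 | c ∈ quaternaryCode ω qs ∧ wt c = 6}.Finite := Set.toFinite _
  have := h.sum_eq hω (fun _ => 1) (fun _ _ => rfl) (T := hfin.toFinset) (by simp)
  rw [numWeight, Set.ncard_eq_toFinset_card _ hfin, Finset.card_eq_sum_ones, this]
  simp

omit hω in
theorem overlap_single {ι : Type*} [Fintype ι] [DecidableEq ι] (x : ι → ZMod 2) (i : ι) :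
    overlap x (Pi.single i 1 : ι → ZMod 2) = if x i ≠ 0 then 1 else 0 := by
  rw [overlap_eq_sum, Finset.sum_eq_single i]
  · simp
  · intro j _ hj
    simp [hj]
  · simp

omit hω in
theorem wt_single {ι : Type*} [Fintype ι] [DecidableEq ι] (i : ι) :
    wt (Pi.single i 1 : ι → ZMod 2) = 1 := by
  rw [wt_eq_card, Finset.card_eq_one]
  refine ⟨i, ?_⟩
  ext j
  simp [Pi.single_apply]

/-- The words of weight 5 of a shadow that lie in a support of weight 6 arise from it by removing a
point. -/
theorem card_pentads {rs : List ℕ} (hB : IsEuclideanSelfDual (binaryCode rs))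
    (σ : Equiv.Perm (Fin 18)) (s : ℕ) {n : ℕ} (hn : pop (supp n) = 6) :
    {x | x ∈ binaryCode rs ∧ wt (word s + x) = 5 ∧
      overlap (word s + x) (fun j => qword ω n (σ.symm j)) = 5}.ncard
      = pentadCount (rs.map (permMask σ)) (permMask σ s) (supp n) := by
  classical
  set S := supp n with hS
  have hwS : wt (word S) = 6 := by rw [wt_word, hn]
  have hov (y : Fin 18 → ZMod 2) :
      overlap y (fun j => qword ω n (σ.symm j)) = overlap (fun j => y (σ j)) (word S) := by
    rw [← overlap_comp_perm _ _ σ]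
    simp only [Equiv.symm_apply_apply]
    exact overlap_congr _ (qword_apply_ne_zero hω n)
  have hmask (i : Fin 18) : word (S ^^^ 2 ^ (i : ℕ) ^^^ permMask σ s)
      = (fun j => word s (σ j)) + (word S + Pi.single i 1) := by
    rw [word_xor, word_xor, word_two_pow, word_permMask, add_comm]
  rw [pentadCount, ← Set.ncard_coe_finset]
  symm
  refine Set.ncard_congr
    (fun i _ => fun j => word (S ^^^ 2 ^ (i : ℕ) ^^^ permMask σ s) (σ.symm j)) ?_ ?_ ?_
  · intro i hi
    simp only [Bool.and_eq_true, Finset.coe_filter, Finset.mem_univ, true_and,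
      Set.mem_ofPred_eq] at hi
    have h1 := wt_add_eq (word S) (Pi.single i 1)
    rw [overlap_single, if_pos ((word_apply_ne_zero S i).2 hi.1), wt_single, hwS] at h1
    have h2 := wt_add_eq (word S + Pi.single i 1) (word S)
    rw [add_right_comm, add_self_eq_zero_zmod_two, zero_add, wt_single, hwS] at h2
    have hy : (fun j => (word s + fun j => word (S ^^^ 2 ^ (i : ℕ) ^^^ permMask σ s) (σ.symm j))
        (σ j)) = word S + Pi.single i 1 := by
      rw [hmask]
      funext j
      simp only [Pi.add_apply, Equiv.symm_apply_apply]
      have key (e f : ZMod 2) : e + (e + f) = f := by revert e f; decide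
      exact key _ _
    refine ⟨(mem_binaryCode_iff_orth hB σ (by simp)).2 hi.2, ?_, ?_⟩
    · rw [← wt_comp_perm _ σ, hy]
      omega
    · rw [hov, hy]
      omega
  · intro i k _ _ h
    have h' : word (S ^^^ 2 ^ (i : ℕ) ^^^ permMask σ s)
        = word (S ^^^ 2 ^ (k : ℕ) ^^^ permMask σ s) := by
      funext j
      simpa using congrFun h (σ j)
    rw [hmask, hmask] at h'
    have h1 := congrFun (add_left_cancel (add_left_cancel h')) i
    by_contra hik
    simp [hik] at h1
  · rintro x ⟨hx, hw, ho⟩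
    rw [hov] at ho
    rw [← wt_comp_perm _ σ] at hw
    have h1 := wt_add_eq (word S) (fun j => (word s + x) (σ j))
    have h2 := wt_add_eq (fun j => (word s + x) (σ j)) (word S)
    rw [add_comm (fun j => (word s + x) (σ j))] at h2
    obtain ⟨i, hi⟩ := exists_eq_single_of_wt_eq_one
      (x := word S + fun j => (word s + x) (σ j)) (by omega)
    have hy := eq_add_of_add_eq hi
    have h3 := wt_add_eq (word S) (Pi.single i 1)
    rw [← hy, overlap_single, wt_single] at h3
    have hiS : word S i ≠ 0 := by
      by_contra h0
      rw [if_neg (not_not.2 h0)] at h3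
      omega
    have hxσ : (fun j => x (σ j)) = word (S ^^^ 2 ^ (i : ℕ) ^^^ permMask σ s) := by
      rw [hmask]
      exact eq_add_of_add_eq hy
    refine ⟨i, ?_, ?_⟩
    · simp only [Bool.and_eq_true, Finset.coe_filter, Finset.mem_univ, true_and, Set.mem_ofPred_eq]
      exact ⟨(word_apply_ne_zero S i).1 hiS, (mem_binaryCode_iff_orth hB σ hxσ).1 hx⟩
    · funext j
      simp only [← hxσ, Equiv.apply_symm_apply]

theorem IsHexadList.numPentads_eq {qs hs : List ℕ} (h : IsHexadList ω qs hs) {rs : List ℕ}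
    (hB : IsEuclideanSelfDual (binaryCode rs)) (σ : Equiv.Perm (Fin 18)) (s : ℕ) :
    numPentads (binaryCode rs) (permCode σ (quaternaryCode ω qs)) (word s)
      = 3 * (hs.map fun n => pentadCount (rs.map (permMask σ)) (permMask σ s) (supp n)).sum := by
  classical
  set g : (Fin 18 → F4) → ℕ := fun q => {x | x ∈ binaryCode rs ∧ wt (word s + x) = 5 ∧
    overlap (word s + x) (fun j => q (σ.symm j)) = 5}.ncard with hg
  have hfin : {c : Fin 18 → F4 | c ∈ quaternaryCode ω qs ∧ wt c = 6}.Finite := Set.toFinite _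
  have hsum := h.sum_eq hω g (fun r q => by
    simp only [hg]
    have (x : Fin 18 → ZMod 2) : overlap (word s + x) (fun j => (r • q) (σ.symm j))
        = overlap (word s + x) (fun j => q (σ.symm j)) :=
      overlap_congr _ fun j => by simp [Units.smul_def]
    simp only [this]) (T := hfin.toFinset) (by simp)
  have hlist : (hs.map fun n => g (qword ω n))
      = hs.map fun n => pentadCount (rs.map (permMask σ)) (permMask σ s) (supp n) :=
    List.map_congr_left fun n hn => card_pentads hω hB σ s (h.pop_eq n hn)
  rw [← hlist, ← hsum, numPentads]
  have hfin' : {p : (Fin 18 → ZMod 2) × (Fin 18 → F4) |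
      (p.1 ∈ binaryCode rs ∧ p.2 ∈ permCode σ (quaternaryCode ω qs)) ∧
      wt (word s + p.1) = 5 ∧ wt p.2 = 6 ∧ overlap (word s + p.1) p.2 = 5}.Finite := Set.toFinite _
  rw [Set.ncard_eq_toFinset_card _ hfin', Finset.card_eq_sum_card_fiberwise
    (f := fun p j => p.2 (σ j)) (t := hfin.toFinset)]
  · refine Finset.sum_congr rfl fun q hq => ?_
    simp only [Set.Finite.mem_toFinset, Set.mem_ofPred_eq] at hq
    rw [hg, ← Set.ncard_coe_finset]
    refine Set.ncard_congr (fun p _ => p.1) ?_ ?_ ?_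
    · rintro ⟨x, d⟩ hp
      simp only [Finset.coe_filter, Set.Finite.mem_toFinset, Set.mem_ofPred_eq] at hp
      obtain ⟨⟨⟨hx, hd⟩, hw, hw6, ho⟩, rfl⟩ := hp
      refine ⟨hx, hw, ?_⟩
      simpa using ho
    · rintro ⟨x, d⟩ ⟨x', d'⟩ hp hp' hxx
      simp only [Finset.coe_filter, Set.Finite.mem_toFinset, Set.mem_ofPred_eq] at hp hp' hxx
      refine Prod.ext hxx (funext fun j => ?_)
      simpa using congrFun (hp.2.trans hp'.2.symm) (σ.symm j)
    · rintro x ⟨hx, hw, ho⟩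
      refine ⟨(x, fun j => q (σ.symm j)), ?_, rfl⟩
      simp only [Finset.coe_filter, Set.Finite.mem_toFinset, Set.mem_ofPred_eq,
        Equiv.symm_apply_apply, and_true]
      refine ⟨⟨hx, by rw [mem_permCode]; simpa using hq.1⟩, hw, ?_, ho⟩
      rw [wt_comp_perm, hq.2]
  · rintro ⟨x, d⟩ hp
    simp only [Set.Finite.coe_toFinset, Set.mem_ofPred_eq] at hp ⊢
    exact ⟨hp.1.2, by rw [wt_comp_perm, hp.2.2.1]⟩

/-- The test for the binary component: minimum weight 4, and the coset of `s` is the shadow. -/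
def shadowCheck (s n : ℕ) : Bool := (n == 0 || Nat.ble 4 (pop n)) && pop (n ^^^ s) % 4 == 1

omit hω in
theorem shadowCheck_spec {rs : List ℕ} {s : ℕ} (h : allBinary (shadowCheck s) rs 0 = true)
    {x : Fin 18 → ZMod 2} (hx : x ∈ binaryCode rs) :
    (x ≠ 0 → 4 ≤ wt x) ∧ wt (word s + x) % 4 = 1 := by
  obtain ⟨m, hm, hxm⟩ := exists_of_allBinary h hx
  rw [word_zero, zero_add] at hxm
  subst hxm
  simp only [shadowCheck, Bool.and_eq_true, Bool.or_eq_true, beq_iff_eq, Nat.ble_eq] at hm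
  refine ⟨fun h0 => ?_, ?_⟩
  · rw [wt_word]
    refine hm.1.resolve_left ?_
    rintro rfl
    exact h0 word_zero
  · rw [add_comm, ← word_xor, wt_word, hm.2]

omit hω in
/-- The conditions on overlaps follow from the checks on supports: a word contained in a support of
equal size is the support, and one of weight 4 in a support of weight 6 omits two points. -/
theorem IsHexadList.isExtremalPair {qs hs : List ℕ} (h : IsHexadList ω qs hs)
    (hQ : IsHermitianSelfDual (quaternaryCode ω qs)) {rs : List ℕ}
    (hB : IsEuclideanSelfDual (binaryCode rs)) {s : ℕ}
    (hs' : allBinary (shadowCheck s) rs 0 = true) (σ : Equiv.Perm (Fin 18))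
    (hoct : ∀ q ∈ quaternaryCode ω qs, wt q = 8 →
      ∃ S, (∀ j, q j ≠ 0 ↔ word S j ≠ 0) ∧ orth (rs.map (permMask σ)) S = false)
    (hhex : ∀ n ∈ hs, avoidsHexad (rs.map (permMask σ)) (supp n) = true) :
    IsExtremalPair (binaryCode rs) (permCode σ (quaternaryCode ω qs)) (word s) := by
  classical
  -- In reordered coordinates the overlap of `x` with a word of support `S` is read off from masks.
  have hred {x : Fin 18 → ZMod 2} {d : Fin 18 → F4} {S : ℕ}
      (hS : ∀ j, d (σ j) ≠ 0 ↔ word S j ≠ 0) :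
      overlap x d = overlap (fun j => x (σ j)) (word S) ∧
      wt (word S + fun j => x (σ j)) + 2 * overlap x d = wt d + wt x := by
    have h1 : overlap x d = overlap (fun j => x (σ j)) (word S) := by
      rw [← overlap_comp_perm x d σ, overlap_congr _ hS]
    refine ⟨h1, ?_⟩
    have h2 := wt_add_eq (fun j => x (σ j)) (word S)
    rw [add_comm (fun j => x (σ j)), wt_comp_perm] at h2
    have h3 : wt d = wt (word S) := by
      rw [← wt_comp_perm d σ]
      exact wt_congr hS
    omega
  have hne {x : Fin 18 → ZMod 2} (hx : x ∈ binaryCode rs) {d : Fin 18 → F4} {S : ℕ}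
      (hS : ∀ j, d (σ j) ≠ 0 ↔ word S j ≠ 0) (ho : orth (rs.map (permMask σ)) S = false)
      (hw : wt d = wt x) : overlap x d ≠ wt x := by
    intro hxd
    have h0 : wt (word S + fun j => x (σ j)) = 0 := by
      have := (hred (x := x) hS).2
      omega
    have hxS := eq_add_of_add_eq (wt_eq_zero.1 h0)
    rw [add_zero] at hxS
    rw [mem_binaryCode_iff_orth hB σ hxS, ho] at hx
    cases hx
  refine ⟨hB, isHermitianSelfDual_permCode σ hQ, fun x hx => (shadowCheck_spec hs' hx).2,
    fun x hx => (shadowCheck_spec hs' hx).1, fun d hd hd0 => ?_, ?_, ?_⟩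
  · rw [← wt_comp_perm d σ]
    refine h.le_wt _ (mem_permCode.1 hd) fun h0 => hd0 (funext fun j => ?_)
    simpa using congrFun h0 (σ.symm j)
  · intro x hx d hd hx4 hd6 ho4
    obtain ⟨n, hn, hS⟩ := h.exists_mem _ (mem_permCode.1 hd) (by rw [wt_comp_perm, hd6])
    obtain ⟨h1, h2⟩ := hred (x := x) hS
    obtain ⟨i, k, hi, hk, hik⟩ := exists_eq_single_add_single_of_wt_eq_two
      (x := word (supp n) + fun j => x (σ j)) (by omega)
    -- The two points outside `x` lie in the support, since `x` is contained in it.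
    have hsub {l : Fin 18} (hl : (word (supp n) + fun j => x (σ j)) l ≠ 0) :
        (supp n).testBit l = true := by
      rw [← word_apply_ne_zero]
      intro h0
      refine ne_zero_of_overlap_eq_wt (x := fun j => x (σ j)) (q := word (supp n)) (j := l) ?_ ?_ h0
      · rw [← h1, ho4, wt_comp_perm, hx4]
      · simpa [h0] using hl
    have hxS := eq_add_of_add_eq hik
    rw [← word_two_pow, ← word_two_pow, ← add_assoc, ← word_xor, ← word_xor] at hxS
    have hav := hhex n hn
    simp only [avoidsHexad, Bool.and_eq_true, decide_eq_true_eq] at hav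
    rw [mem_binaryCode_iff_orth hB σ hxS, hav.2 i (hsub hi) k (hsub hk)] at hx
    cases hx
  · rintro x hx d hd (hx6 | hx8) hw
    · obtain ⟨n, hn, hS⟩ := h.exists_mem _ (mem_permCode.1 hd) (by rw [wt_comp_perm, hw, hx6])
      have hav := hhex n hn
      simp only [avoidsHexad, Bool.and_eq_true, Bool.not_eq_true'] at hav
      exact hne hx hS hav.1 hw
    · obtain ⟨S, hS, ho⟩ := hoct _ (mem_permCode.1 hd) (by rw [wt_comp_perm, hw, hx8])
      exact hne hx hS ho hw

omit hω in
/-- The words of weight 1 of the shadow are the unit vectors that differ from `s` by a codeword. -/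
theorem numUnits_eq {rs : List ℕ} (hB : IsEuclideanSelfDual (binaryCode rs)) (s : ℕ) :
    numUnits (binaryCode rs) (word s)
      = (Finset.univ.filter fun i : Fin 18 => orth rs (2 ^ (i : ℕ) ^^^ s) = true).card := by
  have hmem (i : Fin 18) : orth rs (2 ^ (i : ℕ) ^^^ s) = true ↔
      word s + Pi.single i 1 ∈ binaryCode rs := by
    rw [orth_iff, mem_binaryCode_iff hB, ← word_two_pow, ← word_xor, Nat.xor_comm]
  rw [numUnits, ← Set.ncard_coe_finset]
  symm
  refine Set.ncard_congr (fun i _ => word s + Pi.single i 1) ?_ ?_ ?_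
  · intro i hi
    simp only [Finset.coe_filter, Finset.mem_univ, true_and, Set.mem_ofPred_eq, hmem] at hi
    refine ⟨hi, ?_⟩
    rw [← add_assoc, add_self_eq_zero_zmod_two, zero_add, wt_single]
  · intro i k _ _ h
    have h1 := congrFun (add_left_cancel h) i
    by_contra hik
    simp [hik] at h1
  · rintro x ⟨hx, hw⟩
    obtain ⟨i, hi⟩ := exists_eq_single_of_wt_eq_one hw
    have hxi := eq_add_of_add_eq hi
    refine ⟨i, ?_, hxi.symm⟩
    simp only [Finset.coe_filter, Finset.mem_univ, true_and, Set.mem_ofPred_eq, hmem]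
    rw [← hxi]
    exact hx

end Permuted

/-! ### The fourteen codes -/

section Fourteen

/-- Generators of the two binary self-dual `[18, 9, 4]` codes. The words of weight 4 have the
components `d₆ d₆ d₆` in the first and `d₁₀ e₇ f₁` in the second. -/
def binaryRows : Fin 2 → List ℕ :=
  ![[35329, 88578, 230916, 160776, 238096, 212512, 224832, 100480, 108288],
    [18945, 6658, 231940, 3592, 172048, 207392, 87616, 89216, 109312]]

/-- A word of the shadow of each of the two binary codes. -/
def shadowMask : Fin 2 → ℕ := ![286, 65536]

/-- Generators of two quaternary codes. The first is a double circulant code, with circulant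
block `1, ω², ω², 1, ω, 1, 1, 0, 0`. -/
def quaternaryRows : Fin 2 → List ℕ :=
  ![[2952846849, 5905693698, 11811387396, 23622513160, 47244764688, 25904270368, 51808279104,
       35031037568, 1476554496],
    [17448416257, 65364165634, 56640001028, 31004504584, 49526439440, 11677171744, 15300938304,
       38923346048, 38386489600]]

/-- One word of weight 6 of each quaternary code for each support. -/
def hexads : Fin 2 → List ℕ :=
  ![[151036421, 302072842, 604145684, 673482888, 714096644, 1074074152, 1210601544, 1217433888,
       1242071696, 1346965776, 1428193288, 2148148304, 2290688160, 2421203088, 2434867265,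
       2484143392, 2693931041, 2722430992, 4581376320, 4834330689, 4842406176, 4869734530,
       5444861984, 9684811841],
    [5249537, 15204962, 17489984, 34212384, 67112989, 68526084, 72354332, 83923552, 100694016,
       143163429, 273843252, 274792477, 285350984, 294223874, 341905408, 369656840,
       444601392, 543309976, 673190153, 721963650, 1343557888, 1409331460, 2166440200,
       2186870914, 4328579234, 4345954530, 4834787330, 4966206048, 6443902981, 10762756288,
       11811488768, 17201234513, 23924458496]]

/-- The orders of the coordinates in which the quaternary code is used. -/
def perms : Fin 14 → Fin 18 → Fin 18 :=
  ![![10, 7, 9, 5, 1, 15, 17, 0, 12, 2, 16, 6, 14, 11, 3, 13, 4, 8],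
    ![17, 13, 0, 1, 2, 7, 11, 16, 14, 6, 3, 15, 10, 8, 4, 12, 9, 5],
    ![4, 1, 2, 12, 17, 8, 3, 0, 9, 7, 14, 6, 11, 5, 10, 15, 13, 16],
    ![13, 4, 5, 1, 14, 0, 16, 3, 10, 6, 8, 12, 9, 11, 15, 17, 2, 7],
    ![10, 13, 17, 9, 14, 1, 5, 0, 12, 8, 2, 7, 6, 11, 15, 3, 16, 4],
    ![9, 7, 8, 1, 5, 16, 17, 15, 3, 6, 13, 11, 2, 12, 0, 10, 14, 4],
    ![1, 4, 17, 15, 5, 9, 11, 2, 7, 16, 12, 14, 10, 13, 0, 3, 6, 8],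
    ![16, 7, 10, 12, 5, 11, 17, 13, 1, 0, 3, 15, 8, 4, 2, 14, 6, 9],
    ![2, 5, 16, 15, 13, 17, 1, 10, 9, 0, 14, 7, 6, 3, 4, 11, 8, 12],
    ![3, 17, 5, 7, 4, 6, 0, 10, 13, 15, 9, 12, 14, 11, 8, 16, 2, 1],
    ![11, 10, 0, 2, 4, 12, 3, 6, 5, 16, 14, 9, 15, 17, 7, 1, 13, 8],
    ![14, 10, 4, 13, 2, 17, 3, 5, 1, 11, 7, 9, 0, 12, 15, 6, 8, 16],
    ![4, 11, 2, 12, 15, 1, 8, 6, 17, 10, 9, 7, 13, 3, 16, 14, 5, 0],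
    ![6, 9, 1, 12, 4, 0, 17, 13, 5, 15, 8, 14, 3, 11, 10, 16, 2, 7]]

/-- The binary component of each code: the first eight codes have the enumerators `W₁`. -/
def binaryIndex (k : Fin 14) : Fin 2 := if k < 8 then 0 else 1

/-- The quaternary component of each code. -/
def quaternaryIndex (k : Fin 14) : Fin 2 := if k < 13 then 0 else 1

/-- Generators of the binary component in the order of the coordinates given by `perms k`. -/
def permRows (k : Fin 14) : List ℕ := (binaryRows (binaryIndex k)).map (permMask (perms k))

/-- Continue with the values of a list of lists of numerals. -/
def forceLists {α : Sort*} : List (List ℕ) → (List (List ℕ) → α) → α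
  | [], f => f []
  | l :: ls, f => forceList l fun l' => forceLists ls fun ls' => f (l' :: ls')

theorem forceLists_eq {α : Sort*} (ls : List (List ℕ)) (f : List (List ℕ) → α) :
    forceLists ls f = f ls := by
  induction ls generalizing f with
  | nil => rfl
  | cons l ls ih => rw [forceLists, forceList_eq, ih]

/-- The codes whose quaternary component is the one with index `j`. -/
def codesWith (j : Fin 2) : List (Fin 14) :=
  (List.finRange 14).filter fun k => quaternaryIndex k == j

theorem binary_checks : ∀ i, isSystematic (binaryRows i) = true ∧
    (binaryRows i).all (orth (binaryRows i)) = true ∧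
    allBinary (shadowCheck (shadowMask i)) (binaryRows i) 0 = true := by
  decide +kernel

theorem quaternary_checks : ∀ j, isSystematic (quaternaryRows j) = true ∧
    ((quaternaryRows j).all fun m => (quaternaryRows j).all (hermOrth m)) = true ∧
    ((hexads j).all fun n => pop (supp n) == 6 && (quaternaryRows j).all (hermOrth n)) = true ∧
    ((hexads j).map supp).Nodup := by
  decide +kernel

/-- The exhaustive check of all quaternary words up to scalar multiples, for the first component. -/
theorem allNormalized_zero : (forceList ((hexads 0).map supp) fun H =>
    forceLists ((codesWith 0).map permRows) fun cs =>
      allNormalized (lowWeightCheck H cs) (quaternaryRows 0)) = true := by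
  decide +kernel

/-- The exhaustive check for the second component. -/
theorem allNormalized_one : (forceList ((hexads 1).map supp) fun H =>
    forceLists ((codesWith 1).map permRows) fun cs =>
      allNormalized (lowWeightCheck H cs) (quaternaryRows 1)) = true := by
  decide +kernel

theorem allNormalized_quaternaryRows (j : Fin 2) :
    allNormalized (lowWeightCheck ((hexads j).map supp) ((codesWith j).map permRows))
      (quaternaryRows j) = true := by
  have h0 := allNormalized_zero
  have h1 := allNormalized_one
  rw [forceList_eq, forceLists_eq] at h0 h1
  fin_cases j
  · exact h0
  · exact h1

theorem perms_injective : ∀ k, Function.Injective (perms k) := by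
  decide +kernel

theorem avoidsHexad_permRows : ∀ k, (forceList (permRows k) fun rs =>
    (hexads (quaternaryIndex k)).all fun n => force (supp n) (avoidsHexad rs)) = true := by
  decide +kernel

/-- The numbers of incidences that determine `β`. -/
theorem sum_pentadCount : ∀ k, (forceList (permRows k) fun rs =>
    force (permMask (perms k) (shadowMask (binaryIndex k))) fun s =>
      ((hexads (quaternaryIndex k)).map fun n => force (supp n) (pentadCount rs s)).sum)
        = (k : ℕ) % 8 := by
  decide +kernel

/-- The shadow of the first binary code has no word of weight 1, that of the second has one. -/
theorem card_units : ∀ i, (Finset.univ.filter fun l : Fin 18 =>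
    orth (binaryRows i) (2 ^ (l : ℕ) ^^^ shadowMask i) = true).card = (i : ℕ) := by
  decide +kernel

/-- A word of weight 4 in each binary code. -/
theorem tetrad_checks : ∀ i, orth (binaryRows i) (![4138, 1224] i) = true ∧
    pop (![4138, 1224] i) = 4 := by
  decide +kernel

/-- The two binary components. -/
def binaryComponent (i : Fin 2) : Submodule (ZMod 2) (Fin 18 → ZMod 2) := binaryCode (binaryRows i)

/-- The two quaternary components. -/
noncomputable def quaternaryComponent (ω : F4) (j : Fin 2) : Submodule F4 (Fin 18 → F4) :=
  quaternaryCode ω (quaternaryRows j)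

/-- The order of the coordinates in the quaternary component of the code with index `k`. -/
noncomputable def coordPerm (k : Fin 14) : Equiv.Perm (Fin 18) :=
  Equiv.ofBijective (perms k) (Finite.injective_iff_bijective.1 (perms_injective k))

/-- The code with index `k`. -/
noncomputable def code (ω : F4) (k : Fin 14) : Submodule (ZMod 2) (Fin 3 × Fin 18 → ZMod 2) :=
  cubicConstruction ω (binaryComponent (binaryIndex k))
    (permCode (coordPerm k) (quaternaryComponent ω (quaternaryIndex k)))

theorem selfDual_binaryComponent (i : Fin 2) : IsEuclideanSelfDual (binaryComponent i) :=
  isEuclideanSelfDual_binaryCode (binary_checks i).1 (binary_checks i).2.1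

theorem isLinearCode_binaryComponent (i : Fin 2) : IsLinearCode (binaryComponent i) 18 9 4 := by
  refine ⟨Fintype.card_fin _, ?_, isLeast_dist
    (fun c hc => (shadowCheck_spec (binary_checks i).2.2 hc).1) ?_⟩
  · have := (selfDual_binaryComponent i).two_mul_finrank
    rw [Fintype.card_fin] at this
    omega
  · obtain ⟨h1, h2⟩ := tetrad_checks i
    rw [← wt_word] at h2
    refine ⟨word (![4138, 1224] i), ?_, fun h0 => ?_, h2⟩
    · rw [binaryComponent, mem_binaryCode_iff (selfDual_binaryComponent i)]
      exact orth_iff.1 h1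
    · rw [h0, wt_zero] at h2
      omega

theorem numUnits_binaryComponent (i : Fin 2) :
    numUnits (binaryComponent i) (word (shadowMask i)) = i := by
  rw [binaryComponent, numUnits_eq (selfDual_binaryComponent i), card_units]

/-- The shadow of the second code contains a word of weight 1, that of the first does not. -/
theorem not_permEquiv_binaryComponent : ¬ PermEquiv (binaryComponent 0) (binaryComponent 1) := by
  rintro ⟨σ, hσ⟩
  have h0 := numUnits_binaryComponent 0
  have h1 := numUnits_binaryComponent 1
  set s := word (shadowMask 0)
  set t := word (shadowMask 1)
  obtain ⟨y, hy, hyw⟩ : ∃ y ∈ binaryComponent 1, wt (t + y) = 1 := by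
    by_contra! hne
    rw [numUnits, show {x | x ∈ binaryComponent 1 ∧ wt (t + x) = 1} = ∅ from
      Set.eq_empty_iff_forall_notMem.2 fun x hx => hne x hx.1 hx.2, Set.ncard_empty] at h1
    exact absurd h1 (by decide)
  -- The unit vector `e` is the word of weight 1, carried over to the coordinates of the first code.
  set e : Fin 18 → ZMod 2 := fun j => (t + y) (σ.symm j) with he
  have hew : wt e = 1 := by rw [he, wt_comp_perm, hyw]
  have hes {c : Fin 18 → ZMod 2} (hc : c ∈ binaryComponent 0) : wt (e + c) % 4 = 1 := by
    have hmem := (binaryComponent 1).add_mem hy ((hσ c).1 hc)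
    have := (shadowCheck_spec (binary_checks 1).2.2 hmem).2
    rw [← wt_comp_perm _ σ, show (fun j => (e + c) (σ j)) = t + (y + fun j => c (σ j)) from ?_]
    · exact this
    · funext j
      simp [he, add_assoc]
  have hse : s + e ∈ binaryComponent 0 := by
    rw [selfDual_binaryComponent 0]
    intro c hc
    have hsc := (shadowCheck_spec (binary_checks 0).2.2 hc).2
    have hs0 := (shadowCheck_spec (binary_checks 0).2.2 (Submodule.zero_mem _)).2
    rw [add_zero] at hs0
    have h2 := wt_add_eq s c
    have h3 := wt_add_eq e c
    have h4 := hes hc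
    simp only [Pi.add_apply, add_mul, Finset.sum_add_distrib]
    rw [sum_mul_eq_overlap, sum_mul_eq_overlap, ← Nat.cast_add, ZMod.natCast_eq_zero_iff]
    change wt (s + c) % 4 = 1 at hsc
    change wt s % 4 = 1 at hs0
    omega
  rw [numUnits, Fin.val_zero, Set.ncard_eq_zero] at h0
  refine Set.notMem_empty (s + e) (h0 ▸ ⟨hse, ?_⟩)
  rw [← add_assoc, add_self_eq_zero_zmod_two, zero_add, hew]

variable {ω : F4} (hω : ω ^ 2 + ω + 1 = 0)
include hω

theorem selfDual_quaternaryComponent (j : Fin 2) :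
    IsHermitianSelfDual (quaternaryComponent ω j) :=
  isHermitianSelfDual_quaternaryCode hω (quaternary_checks j).1 (quaternary_checks j).2.1

theorem isHexadList_hexads (j : Fin 2) : IsHexadList ω (quaternaryRows j) (hexads j) := by
  have hall := (quaternary_checks j).2.2.1
  simp only [List.all_eq_true, Bool.and_eq_true, beq_iff_eq] at hall
  refine ⟨fun q hq hq0 => ?_, fun q hq hw => ?_, fun n hn => ?_, fun n hn => (hall n hn).1,
    (quaternary_checks j).2.2.2⟩
  · obtain ⟨S, _, hw, h⟩ := exists_support hω (allNormalized_quaternaryRows j) hq hq0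
    omega
  · have hq0 : q ≠ 0 := by
      rintro rfl
      rw [wt_zero] at hw
      omega
    obtain ⟨S, hS, hw', h⟩ := exists_support hω (allNormalized_quaternaryRows j) hq hq0
    rcases h with h | h | ⟨-, h⟩
    · omega
    · omega
    · obtain ⟨n, hn, rfl⟩ := List.mem_map.1 h
      exact ⟨n, hn, hS⟩
  · have hself := selfDual_quaternaryComponent hω j
    rw [quaternaryComponent] at hself
    rw [hself, quaternaryCode, mem_hermitianDual_span]
    rintro _ ⟨m, hm, rfl⟩
    exact sum_qword_mul_sq hω ((hall n hn).2 m hm)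

theorem isLinearCode_quaternaryComponent (j : Fin 2) :
    IsLinearCode (quaternaryComponent ω j) 18 9 6 := by
  have h := isHexadList_hexads hω j
  refine ⟨Fintype.card_fin _, ?_, isLeast_dist h.le_wt ?_⟩
  · have h1 := finrank_add_finrank_hermitianDual (quaternaryComponent ω j)
    rw [← selfDual_quaternaryComponent hω j, Fintype.card_fin] at h1
    omega
  · obtain ⟨n, hn⟩ : ∃ n, n ∈ hexads j := by
      fin_cases j
      · exact ⟨_, List.mem_cons_self⟩
      · exact ⟨_, List.mem_cons_self⟩
    have hw := h.wt_eq hω hn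
    refine ⟨qword ω n, h.mem n hn, fun h0 => ?_, hw⟩
    rw [h0, wt_zero] at hw
    omega

/-- The numbers of words of weight 6 are 72 and 99. -/
theorem not_semilinearEquiv_quaternaryComponent :
    ¬ SemilinearEquiv (quaternaryComponent ω 0) (quaternaryComponent ω 1) := by
  intro h
  have h6 := h.numWeight_eq 6
  rw [quaternaryComponent, quaternaryComponent, (isHexadList_hexads hω 0).numWeight_six hω,
    (isHexadList_hexads hω 1).numWeight_six hω] at h6
  exact absurd h6 (by decide)

theorem isExtremalPair_code (k : Fin 14) : IsExtremalPair (binaryComponent (binaryIndex k))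
    (permCode (coordPerm k) (quaternaryComponent ω (quaternaryIndex k)))
    (word (shadowMask (binaryIndex k))) := by
  refine (isHexadList_hexads hω _).isExtremalPair (selfDual_quaternaryComponent hω _)
    (selfDual_binaryComponent _) (binary_checks _).2.2 (coordPerm k) (fun q hq hw => ?_)
    fun n hn => ?_
  · have hq0 : q ≠ 0 := by
      rintro rfl
      rw [wt_zero] at hw
      omega
    obtain ⟨S, hS, hw', h⟩ := exists_support hω (allNormalized_quaternaryRows _) hq hq0
    refine ⟨S, hS, ?_⟩
    rcases h with h | ⟨-, h⟩ | h
    · omega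
    · exact h _ (List.mem_map.2 ⟨k, by simp [codesWith], rfl⟩)
    · omega
  · have h := avoidsHexad_permRows k
    simp only [forceList_eq, force_eq, List.all_eq_true] at h
    exact h n hn

theorem numPentads_code (k : Fin 14) : numPentads (binaryComponent (binaryIndex k))
    (permCode (coordPerm k) (quaternaryComponent ω (quaternaryIndex k)))
    (word (shadowMask (binaryIndex k))) = 3 * ((k : ℕ) % 8) := by
  have h := sum_pentadCount k
  simp only [forceList_eq, force_eq] at h
  rw [← h]
  exact (isHexadList_hexads hω _).numPentads_eq hω (selfDual_binaryComponent _) (coordPerm k) _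

theorem hasEnumerator_code_W₁ {k : Fin 14} (hk : k < 8) :
    HasEnumerator (code ω k) (W₁ (3 * (k : ℤ))) := by
  have h := (isExtremalPair_code hω k).hasEnumerator_W₁ hω (by
    rw [numUnits_binaryComponent, binaryIndex, if_pos hk]; rfl)
  rw [numPentads_code hω, Nat.mod_eq_of_lt (show (k : ℕ) < 8 from hk)] at h
  exact_mod_cast h

theorem hasEnumerator_code_W₂ {k : Fin 14} (hk : ¬ k < 8) :
    HasEnumerator (code ω k) (W₂ (3 * (k : ℤ) - 12)) := by
  have h := (isExtremalPair_code hω k).hasEnumerator_W₂ hω (by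
    rw [numUnits_binaryComponent, binaryIndex, if_neg hk]; rfl)
  rw [numPentads_code hω] at h
  have hk' : ¬ (k : ℕ) < 8 := hk
  have hβ : 3 * (k : ℤ) - 12 = (3 * ((k : ℕ) % 8) : ℕ) + 12 := by
    have := k.2
    omega
  rw [hβ]
  exact h

end Fourteen

section Comparison

theorem HasEnumerator.numWeight_W₁ {C : Submodule (ZMod 2) (Fin 3 × Fin 18 → ZMod 2)} {β : ℤ}
    (h : HasEnumerator C (W₁ β)) :
    (numWeight C 10 : ℤ) = 351 - 8 * β ∧ (numWeight C 12 : ℤ) = 5031 + 24 * β := by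
  have h10 := h 10 (by norm_num)
  have h12 := h 12 (by norm_num)
  rw [coeff_weightEnumerator _ (by simp)] at h10 h12
  rw [h10, h12, W₁]
  simp only [coeff_add, coeff_C_mul, coeff_X_pow, coeff_one]
  norm_num

theorem HasEnumerator.numWeight_W₂ {C : Submodule (ZMod 2) (Fin 3 × Fin 18 → ZMod 2)} {β : ℤ}
    (h : HasEnumerator C (W₂ β)) :
    (numWeight C 10 : ℤ) = 351 - 8 * β ∧ (numWeight C 12 : ℤ) = 5543 + 24 * β := by
  have h10 := h 10 (by norm_num)
  have h12 := h 12 (by norm_num)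
  rw [coeff_weightEnumerator _ (by simp)] at h10 h12
  rw [h10, h12, W₂]
  simp only [coeff_add, coeff_C_mul, coeff_X_pow, coeff_one]
  norm_num

theorem numWeight_code {ω : F4} (hω : ω ^ 2 + ω + 1 = 0) (k : Fin 14) :
    (k : ℕ) < 8 ∧ (numWeight (code ω k) 10 : ℤ) = 351 - 24 * k ∧
      (numWeight (code ω k) 12 : ℤ) = 5031 + 72 * k ∨
    8 ≤ (k : ℕ) ∧ (numWeight (code ω k) 10 : ℤ) = 351 - 8 * (3 * k - 12) ∧
      (numWeight (code ω k) 12 : ℤ) = 5543 + 24 * (3 * k - 12) := by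
  by_cases hk : k < 8
  · have h := (hasEnumerator_code_W₁ hω hk).numWeight_W₁
    have hk' : (k : ℕ) < 8 := hk
    omega
  · have h := (hasEnumerator_code_W₂ hω hk).numWeight_W₂
    have hk' : ¬ (k : ℕ) < 8 := hk
    omega

/-- The codes are told apart by their numbers of words of weights 10 and 12. -/
theorem eq_of_permEquiv_code {ω : F4} (hω : ω ^ 2 + ω + 1 = 0) {k l : Fin 14}
    (h : PermEquiv (code ω k) (code ω l)) : k = l := by
  have h10 := h.numWeight_eq 10
  have h12 := h.numWeight_eq 12
  have hk := numWeight_code hω k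
  have hl := numWeight_code hω l
  rw [h10, h12] at hk
  exact Fin.ext (by omega)

end Comparison

end CubicCode

open CubicCode in
theorem mainTheorem1 (ω : F4) (hω : ω ^ 2 + ω + 1 = 0) :
    -- the two binary and the two quaternary component codes
    ∃ (B : Fin 2 → Submodule (ZMod 2) (Fin 18 → ZMod 2))
      (Q : Fin 2 → Submodule F4 (Fin 18 → F4))
      (𝒞 : Finset (Submodule (ZMod 2) (Fin 3 × Fin 18 → ZMod 2))),
      (∀ i, IsEuclideanSelfDual (B i) ∧ IsLinearCode (B i) 18 9 4) ∧
      ¬ PermEquiv (B 0) (B 1) ∧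
      (∀ j, IsHermitianSelfDual (Q j) ∧ IsLinearCode (Q j) 18 9 6) ∧
      ¬ SemilinearEquiv (Q 0) (Q 1) ∧
      -- fourteen pairwise inequivalent codes
      𝒞.card = 14 ∧
      (𝒞 : Set (Submodule (ZMod 2) (Fin 3 × Fin 18 → ZMod 2))).Pairwise
        (fun C D => ¬ PermEquiv C D) ∧
      -- all of them cubic self-dual `[54, 27, 10]` codes of Type I, built from the components
      (∀ C ∈ 𝒞, IsEuclideanSelfDual C ∧ IsLinearCode C 54 27 10 ∧ HasSinglyEvenWord C ∧
        IsQuasiCyclic C ∧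
        ∃ (i j : Fin 2) (D : Submodule F4 (Fin 18 → F4)),
          PermEquiv (Q j) D ∧ C = cubicConstruction ω (B i) D) ∧
      -- each component is used
      (∀ i, ∃ C ∈ 𝒞, ∃ (j : Fin 2) (D : Submodule F4 (Fin 18 → F4)),
        PermEquiv (Q j) D ∧ C = cubicConstruction ω (B i) D) ∧
      (∀ j, ∃ C ∈ 𝒞, ∃ (i : Fin 2) (D : Submodule F4 (Fin 18 → F4)),
        PermEquiv (Q j) D ∧ C = cubicConstruction ω (B i) D) ∧
      -- the weight enumerators
      (∀ β ∈ ({0, 3, 6, 9, 12, 15, 18, 21} : Finset ℤ), ∃ C ∈ 𝒞, HasEnumerator C (W₁ β)) ∧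
      (∀ β ∈ ({12, 15, 18, 21, 24, 27} : Finset ℤ), ∃ C ∈ 𝒞, HasEnumerator C (W₂ β)) ∧
      -- the code with `W₁`, `β = 21` is not equivalent to any code with one of the other thirteen
      (∀ C ∈ 𝒞, HasEnumerator C (W₁ 21) →
        ∀ D : Submodule (ZMod 2) (Fin 3 × Fin 18 → ZMod 2),
          ((∃ β ∈ ({0, 3, 6, 9, 12, 15, 18} : Finset ℤ), HasEnumerator D (W₁ β)) ∨
            (∃ β ∈ ({12, 15, 18, 21, 24, 27} : Finset ℤ), HasEnumerator D (W₂ β))) →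
          ¬ PermEquiv C D) := by
  classical
  refine ⟨binaryComponent, quaternaryComponent ω, Finset.univ.image (code ω),
    fun i => ⟨selfDual_binaryComponent i, isLinearCode_binaryComponent i⟩,
    not_permEquiv_binaryComponent,
    fun j => ⟨selfDual_quaternaryComponent hω j, isLinearCode_quaternaryComponent hω j⟩,
    not_semilinearEquiv_quaternaryComponent hω, ?_, ?_, ?_, ?_, ?_, ?_, ?_, ?_⟩
  · rw [Finset.card_image_of_injective, Finset.card_univ, Fintype.card_fin]
    intro k l hkl
    exact eq_of_permEquiv_code hω (hkl ▸ ⟨Equiv.refl _, fun _ => Iff.rfl⟩)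
  · intro C hC D hD hne h
    simp only [Finset.coe_image, Finset.coe_univ, Set.image_univ, Set.mem_range] at hC hD
    obtain ⟨k, rfl⟩ := hC
    obtain ⟨l, rfl⟩ := hD
    exact hne (congrArg _ (eq_of_permEquiv_code hω h))
  · intro C hC
    obtain ⟨k, -, rfl⟩ := Finset.mem_image.1 hC
    have h := isExtremalPair_code hω k
    obtain ⟨c, hc, hw⟩ : ∃ c ∈ code ω k, wt c = 10 := by
      have hpos : numWeight (code ω k) 10 ≠ 0 := by
        have := numWeight_code hω k
        omega
      obtain ⟨c, hc⟩ := Set.nonempty_of_ncard_ne_zero hpos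
      exact ⟨c, hc.1, hc.2⟩
    refine ⟨h.selfDual hω, ⟨by simp, h.finrank hω, isLeast_dist (fun c => h.le_wt hω)
      ⟨c, hc, fun h0 => ?_, hw⟩⟩, ⟨c, hc, by rw [hw]; norm_num⟩,
      isQuasiCyclic_cubicConstruction hω, binaryIndex k, quaternaryIndex k, _,
      permEquiv_permCode (coordPerm k) _, rfl⟩
    rw [h0, wt_zero] at hw
    omega
  · intro i
    refine ⟨code ω (![0, 8] i), Finset.mem_image_of_mem _ (Finset.mem_univ _),
      quaternaryIndex (![0, 8] i), _, permEquiv_permCode (coordPerm (![0, 8] i)) _, ?_⟩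
    have hi : binaryIndex (![0, 8] i) = i := by revert i; decide
    rw [code, hi]
  · intro j
    refine ⟨code ω (![0, 13] j), Finset.mem_image_of_mem _ (Finset.mem_univ _),
      binaryIndex (![0, 13] j), permCode (coordPerm (![0, 13] j)) (quaternaryComponent ω j),
      permEquiv_permCode _ _, ?_⟩
    have hj : quaternaryIndex (![0, 13] j) = j := by revert j; decide
    rw [code, hj]
  · have hex : ∀ β ∈ ({0, 3, 6, 9, 12, 15, 18, 21} : Finset ℤ),
        ∃ k : Fin 14, k < 8 ∧ β = 3 * (k : ℤ) := by decide
    intro β hβ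
    obtain ⟨k, hk, rfl⟩ := hex β hβ
    exact ⟨code ω k, Finset.mem_image_of_mem _ (Finset.mem_univ _), hasEnumerator_code_W₁ hω hk⟩
  · have hex : ∀ β ∈ ({12, 15, 18, 21, 24, 27} : Finset ℤ),
        ∃ k : Fin 14, ¬ k < 8 ∧ β = 3 * (k : ℤ) - 12 := by decide
    intro β hβ
    obtain ⟨k, hk, rfl⟩ := hex β hβ
    exact ⟨code ω k, Finset.mem_image_of_mem _ (Finset.mem_univ _), hasEnumerator_code_W₂ hω hk⟩
  · intro C _ hC D hD h
    have h10 := h.numWeight_eq 10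
    have h12 := h.numWeight_eq 12
    have hC' := hC.numWeight_W₁
    rcases hD with ⟨β, hβ, hD⟩ | ⟨β, _, hD⟩
    · have hD' := hD.numWeight_W₁
      obtain rfl : β = 21 := by omega
      exact absurd hβ (by decide)
    · have hD' := hD.numWeight_W₂
      omega
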